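/- Let $d\in\mathbb N$, let $\mathbb B^d$ be the open unit ball of $\mathbb C^d$, and write $zw^*=\sum_j z_j\overline{w_j}$. For a complex Hilbert space $H$ and $z\in\mathbb B^d$ let $z^*:H\to H\otimes\mathbb C^d$, $z^*h=(\overline{z_1}h,\dots,\overline{z_d}h)$, with adjoint $z(h_1,\dots,h_d)=\sum_j z_jh_j$. For a contraction $A$ put $D_A=\sqrt{I-A^*A}$; $A$ is pure if $\|Ag\|<\|g\|$ for all $g\neq0$. $\bigvee$ denotes closed linear span. Schur class. $\mathcal S_d(J,K)$ is the set of all $b:\mathbb B^d\to\mathcal L(J,K)$ that act by multiplication as a contraction from $H^2_d\otimes J$ to $H^2_d\otimes K$, where $H^2_d\otimes K$ is the reproducing kernel Hilbert space of $K$-valued functions on $\mathbb B^d$ with kernel $(1-zw^*)^{-1}I_K$. For $b\in\mathcal S_d(J,K)$, $\mathscr H(b)$ is the reproducing kernel Hilbert space with kernel $(I-b(z)b(w)^*)/(1-zw^*)$. A contractive Gleason solution for $b$ is a bounded $\mathbf b=(b_1,\dots,b_d)^T:J\to\mathscr H(b)\otimes\mathbb C^d$ with $b(z)g-b(0)g=\sum_j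 z_j(b_jg)(z)$ for all $z\in\mathbb B^d$, $g\in J$, and $\mathbf b^*\mathbf b\le I-b(0)^*b(0)$; it is extremal if equality holds. $b$ is a quasi-extreme multiplier if $b(z)$ is a pure contraction for every $z\in\mathbb B^d$ and $b$ has a unique contractive Gleason solution, and this solution is extremal. Weak coincidence. The support of an operator-valued function $b$ on $\mathbb B^d$ is $\mathrm{supp}(b)=\bigvee_{z}\mathrm{ran}\,b(z)^*$. Two such functions $b_1,b_2$ coincide weakly if there are unitaries $R,Q$ with $R\,b_1(z)|_{\mathrm{supp}(b_1)}=b_2(z)|_{\mathrm{supp}(b_2)}\,Q$ for all $z\in\mathbb B^d$. Characteristic function. Let $T:H\otimes\mathbb C^d\to H$ be a row contraction, i.e. $\|T\|\le1$. $T$ is CCNC if $$H=\bigvee_{z\in\mathbb B^d}(I-Tz^*)^{-1}\,\mathrm{ran}\,D_{T^*}.$$ Let $V=TP_{\ker D_T}$, a row partial isometry. A model triple $(\gamma,J_\infty,J_0)$ for $V$ consists of Hilbert spaces $J_\infty,J_0$, for each $z\in\mathbb B^d$ a bounded linear isomorphism $\gamma(z)$ of $J_0$ onto $\left(\mathrm{ran}\,(V-z)V^*V\right)^\perp$,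 isometric for $z=0$, and an isometry $\gamma(\infty)$ of $J_\infty$ onto $\ker V$. Put $b_V(z)=\left(\gamma(z)^*\gamma(0)\right)^{-1}z\,(\gamma(z)^*\otimes I_d)\gamma(\infty)$ and $\delta=-\gamma(0)^*T\gamma(\infty)$, a pure contraction. If $T$ is CCNC, its characteristic function is $$b_T(z)=D_{\delta^*}^{-1}\left(b_V(z)+\delta\right)\left(I+\delta^*b_V(z)\right)^{-1}D_\delta\in\mathcal L(J_\infty,J_0),$$ which up to weak coincidence does not depend on the model triple. $T$ is quasi-extreme (QE) if it is CCNC and $b_T$ coincides weakly with a quasi-extreme multiplier. Theorem. A row contraction $T:H\otimes\mathbb C^d\to H$ is QE if and only if both of the following hold: $T$ is CCNC, that is, $$\bigvee_{z\in\mathbb B^d}(I-Tz^*)^{-1}\,\mathrm{ran}\,D_{T^*}=H,$$ and $T$ obeys the QE condition $$(\ker T)^\perp\subseteq\bigvee_{z\in\mathbb B^d}z^*(I-Tz^*)^{-1}\,\mathrm{ran}\,D_{T^*}.$$ -/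

import Mathlib

open scoped InnerProductSpace ComplexOrder

noncomputable section

/-! ### The ball, `H ⊗ ℂ^d`, and the row operators `z`, `z*` -/

/-- The open unit ball `𝔹^d` of `ℂ^d`, as a type. -/
abbrev UBall (d : ℕ) : Type := Metric.ball (0 : EuclideanSpace ℂ (Fin d)) 1

/-- The centre of the ball. -/
def UBall.zero (d : ℕ) : UBall d := ⟨0, by simp⟩

/-- `z w* = ∑ j, z_j * conj w_j`. -/
def UBall.dot {d : ℕ} (z w : UBall d) : ℂ := ⟪w.1, z.1⟫_ℂ

/-- The Hilbert space `H ⊗ ℂ^d`, realised as the direct sum of `d` copies of `H`. -/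
abbrev Amp (d : ℕ) (H : Type*) : Type _ := PiLp 2 (fun _ : Fin d => H)

section RowOperators

variable {d : ℕ} {H K : Type*} [NormedAddCommGroup H] [InnerProductSpace ℂ H]
  [NormedAddCommGroup K] [InnerProductSpace ℂ K]

/-- The column operator `(A_1, …, A_d)ᵀ : H → K ⊗ ℂ^d`. -/
def colOp (A : Fin d → H →L[ℂ] K) : H →L[ℂ] Amp d K :=
  ((PiLp.continuousLinearEquiv 2 ℂ (fun _ : Fin d => K)).symm :
    (Fin d → K) →L[ℂ] Amp d K) ∘L ContinuousLinearMap.pi A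

/-- `z* : H → H ⊗ ℂ^d`, `h ↦ (conj z_1 h, …, conj z_d h)ᵀ`. -/
def starCol (H : Type*) [NormedAddCommGroup H] [InnerProductSpace ℂ H]
    (z : UBall d) : H →L[ℂ] Amp d H :=
  colOp fun j => (starRingEnd ℂ (z.1 j)) • ContinuousLinearMap.id ℂ H

/-- `z : H ⊗ ℂ^d → H`, `(h_1, …, h_d)ᵀ ↦ ∑ j, z_j h_j`. -/
def rowOp (H : Type*) [NormedAddCommGroup H] [InnerProductSpace ℂ H]
    (z : UBall d) : Amp d H →L[ℂ] H :=
  ∑ j, z.1 j • PiLp.proj 2 (𝕜 := ℂ) (fun _ : Fin d => H) j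

/-- The ampliation `A ⊗ I_d`. -/
def ampOp (d : ℕ) (A : H →L[ℂ] K) : Amp d H →L[ℂ] Amp d K :=
  colOp fun j => A ∘L PiLp.proj 2 (𝕜 := ℂ) (fun _ : Fin d => H) j

end RowOperators

/-! ### Defect operators, the CCNC condition and the QE condition -/

section RowContractions

variable {H K : Type*} [NormedAddCommGroup H] [InnerProductSpace ℂ H] [CompleteSpace H]
  [NormedAddCommGroup K] [InnerProductSpace ℂ K] [CompleteSpace K]

/-- The defect operator `D_T = √(I - T* T)` of a contraction `T`. -/
def defectOp (T : H →L[ℂ] K) : H →L[ℂ] H :=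
  CFC.sqrt (1 - ContinuousLinearMap.adjoint T ∘L T)

/-- A contraction `T` is pure if `‖T h‖ < ‖h‖` for every nonzero `h`. -/
def IsPureContraction (T : H →L[ℂ] K) : Prop := ∀ h, h ≠ 0 → ‖T h‖ < ‖h‖

variable {d : ℕ}

/-- `(I - T z*)⁻¹`. -/
def resolv (T : Amp d H →L[ℂ] H) (z : UBall d) : H →L[ℂ] H :=
  Ring.inverse (1 - T ∘L starCol H z)

/-- The subspace `(I - T z*)⁻¹ ran D_{T*}`. -/
def resolvDefect (T : Amp d H →L[ℂ] H) (z : UBall d) : Submodule ℂ H :=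
  (LinearMap.range (defectOp (ContinuousLinearMap.adjoint T) : H →ₗ[ℂ] H)).map
    (resolv T z : H →ₗ[ℂ] H)

/-- The commutative CNC condition: `H` is the closed linear span of the subspaces
`(I - T z*)⁻¹ ran D_{T*}`, `z ∈ 𝔹^d`. -/
def IsCCNC (T : Amp d H →L[ℂ] H) : Prop :=
  (⨆ z : UBall d, resolvDefect T z).topologicalClosure = ⊤

/-- The QE condition: `(ker T)ᗮ` is contained in the closed linear span of the subspaces
`z* (I - T z*)⁻¹ ran D_{T*}`, `z ∈ 𝔹^d`. -/
def SatisfiesQECondition (T : Amp d H →L[ℂ] H) : Prop :=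
  (LinearMap.ker (T : Amp d H →ₗ[ℂ] H))ᗮ ≤
    (⨆ z : UBall d, (resolvDefect T z).map (starCol H z : H →ₗ[ℂ] Amp d H)).topologicalClosure

/-- The partial isometric part `V = T P`, `P` the projection onto `ker D_T`, in the
isometric-pure decomposition `T = V - C` of a row contraction. -/
def isometricPart (T : Amp d H →L[ℂ] H) : Amp d H →L[ℂ] H :=
  T ∘L (LinearMap.ker (defectOp T : Amp d H →ₗ[ℂ] Amp d H)).starProjection

/-- The `z`-defect space: the orthogonal complement of `ran ((V - z) V* V)`. -/
def defectSpace (V : Amp d H →L[ℂ] H) (z : UBall d) : Submodule ℂ H :=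
  (LinearMap.range
    (((V - rowOp H z) ∘L ContinuousLinearMap.adjoint V ∘L V : Amp d H →L[ℂ] H) :
      Amp d H →ₗ[ℂ] H))ᗮ

end RowContractions

/-! ### Drury–Arveson space, the Schur class and de Branges–Rovnyak spaces -/

section SchurClass

variable (d : ℕ) (J K : Type*) [NormedAddCommGroup J] [InnerProductSpace ℂ J] [CompleteSpace J]
  [NormedAddCommGroup K] [InnerProductSpace ℂ K] [CompleteSpace K]

/-- The several-variable Szegő kernel `k(z, w) = (1 - z w*)⁻¹ I`. -/
def szegoKernel : Matrix (UBall d) (UBall d) (K →L[ℂ] K) :=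
  .of fun z w => (1 - UBall.dot z w)⁻¹ • ContinuousLinearMap.id ℂ K

theorem UBall.norm_dot_lt {d : ℕ} (z w : UBall d) : ‖UBall.dot z w‖ < 1 := by
  have hz := mem_ball_zero_iff.1 z.2
  have hw := mem_ball_zero_iff.1 w.2
  calc ‖UBall.dot z w‖ ≤ ‖w.1‖ * ‖z.1‖ := norm_inner_le_norm _ _
    _ < 1 := by nlinarith [norm_nonneg w.1, norm_nonneg z.1]

theorem UBall.conj_dot {d : ℕ} (z w : UBall d) :
    starRingEnd ℂ (UBall.dot z w) = UBall.dot w z := by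
  simp [UBall.dot, inner_conj_symm]

theorem szego_pow_nonneg {d : ℕ} {K : Type*} [NormedAddCommGroup K] [InnerProductSpace ℂ K]
    (s : Finset (UBall d)) (n : ℕ) : ∀ v : UBall d → K,
    0 ≤ RCLike.re (∑ x ∈ s, ∑ y ∈ s, (UBall.dot x y) ^ n * ⟪v x, v y⟫_ℂ) := by
  induction n with
  | zero =>
    intro v
    have : ∑ x ∈ s, ∑ y ∈ s, (UBall.dot x y) ^ 0 * ⟪v x, v y⟫_ℂ
        = ⟪∑ x ∈ s, v x, ∑ y ∈ s, v y⟫_ℂ := by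
      simp only [pow_zero, one_mul, sum_inner, inner_sum]
      exact Finset.sum_comm
    rw [this]
    exact inner_self_nonneg
  | succ n ih =>
    intro v
    have : ∑ x ∈ s, ∑ y ∈ s, (UBall.dot x y) ^ (n + 1) * ⟪v x, v y⟫_ℂ
        = ∑ k, ∑ x ∈ s, ∑ y ∈ s, (UBall.dot x y) ^ n *
          ⟪(starRingEnd ℂ (x.1 k)) • v x, (starRingEnd ℂ (y.1 k)) • v y⟫_ℂ := by
      rw [Finset.sum_comm (s := Finset.univ)]
      refine Finset.sum_congr rfl fun x _ => ?_
      rw [Finset.sum_comm (s := Finset.univ)]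
      refine Finset.sum_congr rfl fun y _ => ?_
      rw [← Finset.mul_sum, pow_succ, mul_assoc]
      congr 1
      simp only [inner_smul_left, inner_smul_right, UBall.dot, PiLp.inner_apply,
        Finset.sum_mul, RCLike.inner_apply, Complex.conj_conj]
      refine Finset.sum_congr rfl fun k _ => ?_
      ring
    rw [this, map_sum]
    exact Finset.sum_nonneg fun k _ => ih _

theorem szegoKernel_posSemidef : (szegoKernel d K).PosSemidef := by
  have key := (RKHS.posSemidef_tfae (K := szegoKernel d K)).out 0 2
  refine key.2 ⟨?_, fun vv => ?_⟩
  · ext1 x y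
    refine ContinuousLinearMap.ext fun v => ext_inner_right ℂ fun w => ?_
    simp [szegoKernel, Matrix.conjTranspose_apply, ContinuousLinearMap.star_eq_adjoint,
      inner_smul_left, UBall.conj_dot, ContinuousLinearMap.adjoint_inner_left]
  · have h : HasSum (fun n : ℕ => RCLike.re (∑ x ∈ vv.support, ∑ y ∈ vv.support,
        (UBall.dot x y) ^ n * ⟪vv x, vv y⟫_ℂ))
        (RCLike.re (∑ x ∈ vv.support, ∑ y ∈ vv.support,
        (1 - UBall.dot x y)⁻¹ * ⟪vv x, vv y⟫_ℂ)) := by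
      refine (RCLike.reCLM (K := ℂ)).hasSum ?_
      refine hasSum_sum fun x _ => hasSum_sum fun y _ => ?_
      exact (hasSum_geometric_of_norm_lt_one (UBall.norm_dot_lt x y)).mul_right _
    have h2 := h.nonneg fun n => szego_pow_nonneg vv.support n vv
    simpa [Finsupp.sum, szegoKernel, inner_smul_left, UBall.conj_dot] using h2

instance : Fact (szegoKernel d K).PosSemidef := ⟨szegoKernel_posSemidef d K⟩

/-- The vector-valued Drury–Arveson space `H²_d ⊗ K`: the reproducing kernel Hilbert space of
`K`-valued functions on the ball with the Szegő kernel. -/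
def DruryArveson : Type _ := RKHS.OfKernel (szegoKernel d K)

instance : NormedAddCommGroup (DruryArveson d K) :=
  inferInstanceAs (NormedAddCommGroup (RKHS.OfKernel (szegoKernel d K)))

instance : InnerProductSpace ℂ (DruryArveson d K) :=
  inferInstanceAs (InnerProductSpace ℂ (RKHS.OfKernel (szegoKernel d K)))

instance : CompleteSpace (DruryArveson d K) :=
  inferInstanceAs (CompleteSpace (RKHS.OfKernel (szegoKernel d K)))

instance : RKHS ℂ (DruryArveson d K) (UBall d) K :=
  inferInstanceAs (RKHS ℂ (RKHS.OfKernel (szegoKernel d K)) (UBall d) K)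

theorem kernel_druryArveson : RKHS.kernel (DruryArveson d K) = szegoKernel d K :=
  RKHS.OfKernel.kernel_ofKernel

theorem inner_kerFun_druryArveson {d : ℕ} {K : Type*} [NormedAddCommGroup K]
    [InnerProductSpace ℂ K] [CompleteSpace K] (x y : UBall d) (v w : K) :
    ⟪RKHS.kerFun (DruryArveson d K) x v, RKHS.kerFun (DruryArveson d K) y w⟫_ℂ
      = (1 - UBall.dot x y)⁻¹ * ⟪v, w⟫_ℂ := by
  rw [← RKHS.kernel_inner, kernel_druryArveson]
  simp [szegoKernel, inner_smul_left, UBall.conj_dot]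

/-- The Schur class `𝒮_d(J, K)`: the `L(J, K)`-valued functions `b` on the ball such that
multiplication by `b` is a contraction from `H²_d ⊗ J` into `H²_d ⊗ K`. -/
structure SchurClass where
  toFun : UBall d → J →L[ℂ] K
  exists_mul : ∃ M : DruryArveson d J →L[ℂ] DruryArveson d K,
    ‖M‖ ≤ 1 ∧ ∀ (f : DruryArveson d J) (z : UBall d), M f z = toFun z (f z)

variable {d J K}

/-- The de Branges–Rovnyak kernel `k^b(z, w) = (1 - z w*)⁻¹ (I - b(z) b(w)*)`. -/
def dbrKernel (b : UBall d → J →L[ℂ] K) : Matrix (UBall d) (UBall d) (K →L[ℂ] K) :=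
  .of fun z w => (1 - UBall.dot z w)⁻¹ •
    (ContinuousLinearMap.id ℂ K - b z ∘L ContinuousLinearMap.adjoint (b w))

theorem dbrKernel_posSemidef (b : SchurClass d J K) : (dbrKernel b.toFun).PosSemidef := by
  obtain ⟨M, hM, hmul⟩ := b.exists_mul
  have hadj (x : UBall d) (v : K) : ContinuousLinearMap.adjoint M
      (RKHS.kerFun (DruryArveson d K) x v) =
      RKHS.kerFun (DruryArveson d J) x (ContinuousLinearMap.adjoint (b.toFun x) v) := by
    refine ext_inner_right ℂ fun f => ?_
    rw [ContinuousLinearMap.adjoint_inner_left, RKHS.kerFun_inner, RKHS.kerFun_inner, hmul,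
      ContinuousLinearMap.adjoint_inner_left]
  have key := (RKHS.posSemidef_tfae (K := dbrKernel b.toFun)).out 0 2
  refine key.2 ⟨?_, fun vv => ?_⟩
  · ext1 x y
    refine ContinuousLinearMap.ext fun v => ext_inner_right ℂ fun w => ?_
    simp [dbrKernel, Matrix.conjTranspose_apply, ContinuousLinearMap.star_eq_adjoint,
      inner_smul_left, UBall.conj_dot, inner_sub_left, ContinuousLinearMap.adjoint_inner_left]
  · set F : DruryArveson d K := ∑ x ∈ vv.support, RKHS.kerFun (DruryArveson d K) x (vv x) with hF
    have h1 : vv.sum (fun x w => vv.sum fun x' w' => ⟪dbrKernel b.toFun x' x w, w'⟫_ℂ)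
        = ⟪F, F⟫_ℂ - ⟪ContinuousLinearMap.adjoint M F, ContinuousLinearMap.adjoint M F⟫_ℂ := by
      simp only [hF, map_sum, hadj, sum_inner, inner_sum, Finsupp.sum, ← Finset.sum_sub_distrib]
      rw [Finset.sum_comm]
      refine Finset.sum_congr rfl fun x _ => Finset.sum_congr rfl fun y _ => ?_
      rw [inner_kerFun_druryArveson, inner_kerFun_druryArveson]
      simp [dbrKernel, UBall.conj_dot, ContinuousLinearMap.adjoint_inner_right]
      ring
    rw [h1, map_sub, inner_self_eq_norm_sq, inner_self_eq_norm_sq, sub_nonneg]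
    have h2 : ‖ContinuousLinearMap.adjoint M F‖ ≤ ‖F‖ := by
      refine (ContinuousLinearMap.le_opNorm _ _).trans ?_
      rw [LinearIsometryEquiv.norm_map]
      exact mul_le_of_le_one_left (norm_nonneg _) hM
    gcongr

instance (b : SchurClass d J K) : Fact (dbrKernel b.toFun).PosSemidef := ⟨dbrKernel_posSemidef b⟩

/-- The de Branges–Rovnyak space `ℋ(b)`: the reproducing kernel Hilbert space of `K`-valued
functions on the ball with the kernel `k^b`. -/
def DBRSpace (b : SchurClass d J K) : Type _ := RKHS.OfKernel (dbrKernel b.toFun)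

instance (b : SchurClass d J K) : NormedAddCommGroup (DBRSpace b) :=
  inferInstanceAs (NormedAddCommGroup (RKHS.OfKernel (dbrKernel b.toFun)))

instance (b : SchurClass d J K) : InnerProductSpace ℂ (DBRSpace b) :=
  inferInstanceAs (InnerProductSpace ℂ (RKHS.OfKernel (dbrKernel b.toFun)))

instance (b : SchurClass d J K) : CompleteSpace (DBRSpace b) :=
  inferInstanceAs (CompleteSpace (RKHS.OfKernel (dbrKernel b.toFun)))

instance (b : SchurClass d J K) : RKHS ℂ (DBRSpace b) (UBall d) K :=
  inferInstanceAs (RKHS ℂ (RKHS.OfKernel (dbrKernel b.toFun)) (UBall d) K)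

theorem kernel_dbrSpace (b : SchurClass d J K) :
    RKHS.kernel (DBRSpace b) = dbrKernel b.toFun :=
  RKHS.OfKernel.kernel_ofKernel

namespace SchurClass

variable (b : SchurClass d J K)

/-- `B : J → ℋ(b) ⊗ ℂ^d` solves the Gleason problem for `b`: `b(z) - b(0) = ∑ j, z_j B_j(z)`. -/
def IsGleasonSolution (B : J →L[ℂ] Amp d (DBRSpace b)) : Prop :=
  ∀ (z : UBall d) (g : J),
    b.toFun z g - b.toFun (UBall.zero d) g = ∑ j, z.1 j • (B g j : DBRSpace b) z

/-- A contractive Gleason solution for `b`: `B* B ≤ I - b(0)* b(0)`. -/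
def IsContractiveGleasonSolution (B : J →L[ℂ] Amp d (DBRSpace b)) : Prop :=
  b.IsGleasonSolution B ∧ ContinuousLinearMap.adjoint B ∘L B ≤
    ContinuousLinearMap.id ℂ J -
      ContinuousLinearMap.adjoint (b.toFun (UBall.zero d)) ∘L b.toFun (UBall.zero d)

/-- An extremal Gleason solution for `b`: `B* B = I - b(0)* b(0)`. -/
def IsExtremalGleasonSolution (B : J →L[ℂ] Amp d (DBRSpace b)) : Prop :=
  b.IsGleasonSolution B ∧ ContinuousLinearMap.adjoint B ∘L B =
    ContinuousLinearMap.id ℂ J -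
      ContinuousLinearMap.adjoint (b.toFun (UBall.zero d)) ∘L b.toFun (UBall.zero d)

/-- `b` is a quasi-extreme Schur multiplier: it is purely contractive, it has a unique contractive
Gleason solution, and this solution is extremal. -/
def IsQuasiExtreme : Prop :=
  (∀ z, IsPureContraction (b.toFun z)) ∧
  ∃ B : J →L[ℂ] Amp d (DBRSpace b), b.IsContractiveGleasonSolution B ∧
    b.IsExtremalGleasonSolution B ∧ ∀ B', b.IsContractiveGleasonSolution B' → B' = B

end SchurClass

end SchurClass

/-! ### Weak coincidence -/

section Coincidence

variable {d : ℕ} {J₁ K₁ J₂ K₂ : Type*}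
  [NormedAddCommGroup J₁] [InnerProductSpace ℂ J₁]
  [NormedAddCommGroup K₁] [InnerProductSpace ℂ K₁]
  [NormedAddCommGroup J₂] [InnerProductSpace ℂ J₂]
  [NormedAddCommGroup K₂] [InnerProductSpace ℂ K₂]

/-- `b₁` and `b₂` coincide: `R b₁(z) = b₂(z) Q` for fixed unitaries `R`, `Q`. -/
def Coincide (b₁ : UBall d → J₁ →L[ℂ] K₁) (b₂ : UBall d → J₂ →L[ℂ] K₂) : Prop :=
  ∃ (R : K₁ ≃ₗᵢ[ℂ] K₂) (Q : J₁ ≃ₗᵢ[ℂ] J₂), ∀ z g, R (b₁ z g) = b₂ z (Q g)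

variable [CompleteSpace J₁] [CompleteSpace K₁] [CompleteSpace J₂] [CompleteSpace K₂]

/-- The support of `b`: the closed linear span of the ranges of `b(z)*`, `z ∈ 𝔹^d`. -/
def suppSpace (b : UBall d → J₁ →L[ℂ] K₁) : Submodule ℂ J₁ :=
  (⨆ z : UBall d, LinearMap.range
    (ContinuousLinearMap.adjoint (b z) : K₁ →ₗ[ℂ] J₁)).topologicalClosure

/-- The restriction of `b` to its support. -/
def restrictSupp (b : UBall d → J₁ →L[ℂ] K₁) (z : UBall d) : suppSpace b →L[ℂ] K₁ :=
  b z ∘L (suppSpace b).subtypeL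

/-- `b₁` and `b₂` coincide weakly: their restrictions to their supports coincide. -/
def CoincideWeakly (b₁ : UBall d → J₁ →L[ℂ] K₁) (b₂ : UBall d → J₂ →L[ℂ] K₂) : Prop :=
  Coincide (restrictSupp b₁) (restrictSupp b₂)

end Coincidence

/-! ### Model triples, characteristic functions, QE row contractions -/

section CharacteristicFunctions

variable {d : ℕ} {H Jinf Jzero : Type*}
  [NormedAddCommGroup H] [InnerProductSpace ℂ H] [CompleteSpace H]
  [NormedAddCommGroup Jinf] [InnerProductSpace ℂ Jinf] [CompleteSpace Jinf]
  [NormedAddCommGroup Jzero] [InnerProductSpace ℂ Jzero] [CompleteSpace Jzero]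

/-- A model triple `(γ, Jinf, Jzero)` for a row partial isometry `V`: isomorphisms `γ(z)` of
`Jzero` onto the `z`-defect space of `V` for `z ∈ 𝔹^d`, with `γ(0)` isometric, and an isometry
`γ(∞)` of `Jinf` onto `ker V`. -/
structure ModelTriple (V : Amp d H →L[ℂ] H) (Jinf Jzero : Type*)
    [NormedAddCommGroup Jinf] [InnerProductSpace ℂ Jinf]
    [NormedAddCommGroup Jzero] [InnerProductSpace ℂ Jzero] where
  atBall : ∀ z : UBall d, Jzero ≃L[ℂ] defectSpace V z
  atZero_isometry : ∀ g, ‖atBall (UBall.zero d) g‖ = ‖g‖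
  atInfty : Jinf ≃ₗᵢ[ℂ] LinearMap.ker (V : Amp d H →ₗ[ℂ] H)

namespace ModelTriple

variable {V : Amp d H →L[ℂ] H} (γ : ModelTriple V Jinf Jzero)

/-- `γ(z)` as an operator into `H`. -/
def op (z : UBall d) : Jzero →L[ℂ] H :=
  (defectSpace V z).subtypeL ∘L (γ.atBall z : Jzero →L[ℂ] defectSpace V z)

/-- `γ(∞)` as an operator into `H ⊗ ℂ^d`. -/
def opInfty : Jinf →L[ℂ] Amp d H :=
  (LinearMap.ker (V : Amp d H →ₗ[ℂ] H)).subtypeL ∘L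
    (γ.atInfty.toContinuousLinearEquiv : Jinf →L[ℂ] LinearMap.ker (V : Amp d H →ₗ[ℂ] H))

/-- `D(z) = γ(z)* γ(0)`. -/
def opD (z : UBall d) : Jzero →L[ℂ] Jzero :=
  ContinuousLinearMap.adjoint (γ.op z) ∘L γ.op (UBall.zero d)

/-- `N(z) = (γ(z)* ⊗ I_d) γ(∞)`. -/
def opN (z : UBall d) : Jinf →L[ℂ] Amp d Jzero :=
  ampOp d (ContinuousLinearMap.adjoint (γ.op z)) ∘L γ.opInfty

/-- The characteristic function `b_V(z) = D(z)⁻¹ z N(z)` of the row partial isometry `V`. -/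
def charFun (z : UBall d) : Jinf →L[ℂ] Jzero :=
  Ring.inverse (γ.opD z) ∘L rowOp Jzero z ∘L γ.opN z

/-- The zero-point contraction `δ = - γ(0)* T γ(∞)` of `T`. -/
def zeroPoint (T : Amp d H →L[ℂ] H) : Jinf →L[ℂ] Jzero :=
  -(ContinuousLinearMap.adjoint (γ.op (UBall.zero d)) ∘L T ∘L γ.opInfty)

end ModelTriple

/-- `b` is the characteristic function of `T` computed from the model triple `γ` of the partial
isometric part of `T`, i.e. the `δ`-Frostman shift
`b(z) = D_{δ*}⁻¹ (b_V(z) + δ) (I + δ* b_V(z))⁻¹ D_δ`, with `δ` the zero-point contraction of `T`.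
As `δ` is a pure contraction, `D_{δ*}` is injective, and its (possibly unbounded) inverse is moved
to the other side of the equation. -/
def IsCharFunFor (T : Amp d H →L[ℂ] H) (γ : ModelTriple (isometricPart T) Jinf Jzero)
    (b : UBall d → Jinf →L[ℂ] Jzero) : Prop :=
  ∀ z, defectOp (ContinuousLinearMap.adjoint (γ.zeroPoint T)) ∘L b z =
    (γ.charFun z + γ.zeroPoint T) ∘L
      Ring.inverse (1 + ContinuousLinearMap.adjoint (γ.zeroPoint T) ∘L γ.charFun z) ∘L
        defectOp (γ.zeroPoint T)

end CharacteristicFunctions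

universe u

/-- A row contraction `T` is quasi-extreme (QE) if it is CCNC and its characteristic function
(which does not depend, up to coincidence, on the model triple) coincides weakly with a
quasi-extreme Schur multiplier. -/
def IsQE {d : ℕ} {H : Type u} [NormedAddCommGroup H] [InnerProductSpace ℂ H] [CompleteSpace H]
    (T : Amp d H →L[ℂ] H) : Prop :=
  IsCCNC T ∧
  ∃ (Jinf : Type u) (_ : NormedAddCommGroup Jinf) (_ : InnerProductSpace ℂ Jinf)
    (_ : CompleteSpace Jinf)
    (Jzero : Type u) (_ : NormedAddCommGroup Jzero) (_ : InnerProductSpace ℂ Jzero)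
    (_ : CompleteSpace Jzero)
    (γ : ModelTriple (isometricPart T) Jinf Jzero) (bT : UBall d → Jinf →L[ℂ] Jzero),
    IsCharFunFor T γ bT ∧
    ∃ (J : Type u) (_ : NormedAddCommGroup J) (_ : InnerProductSpace ℂ J) (_ : CompleteSpace J)
      (K : Type u) (_ : NormedAddCommGroup K) (_ : InnerProductSpace ℂ K) (_ : CompleteSpace K)
      (b : SchurClass d J K), b.IsQuasiExtreme ∧ CoincideWeakly bT b.toFun

end

/-! In the coordinates of a model triple, `b_T` is the transfer function `Θ(z) = δ + K(z)* z D_δ`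
with `K(z) = (I - T z*)⁻¹ D_{T*}` (`isCharFunFor_iff`, which rests on `frostman` and `charFun_eq`).
The Julia operator of `T` is isometric, hence `(1 - z w*) ⟪K(z) u, K(w) v⟫ = ⟪u, v⟫ - ⟪Θ(z)* u,
Θ(w)* v⟫` (`inner_kerVec`). So `Θ` is a Schur multiplier, and CCNC says precisely that the `K(z) u`
are total in `H`. Under CCNC the map `k_z u ↦ K(z) u` is therefore a unitary from `ℋ(Θ)` onto `H`.

Carried over to `H`, a Gleason solution is an operator `X` into `H ⊗ ℂ^d` with `Θ(z) - Θ(0) = K(z)*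
z X`. One of them is visible, `σ = D_T` in model coordinates, and it is extremal. Any two solutions
differ by an operator into `Mᗮ`, where `M` is the closed span of the `z* ran K(z)`. If `ran σ ⊆ M`,
Pythagoras makes every solution other than `σ` too large to be contractive; if not, compressing `σ`
to `M` gives a second contractive solution. Hence `b` has a unique contractive solution, extremal as
well, if and only if `ran σ ⊆ M` (`SchurClass.hasUniqueExtremalSolution_iff`).

The identity `D_T Θ(z)* = (z* - T*) K(z)` links this to the QE condition: since `z* K(z) u ∈ M`, the
operator `D_T` sends the support of `Θ` into `M` if and only if `T*` sends every `K(z) u`, hence by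
CCNC all of `H`, into `M`. As `(ker T)ᗮ` is the closure of `ran T*`, this is the QE condition
(`satisfiesQECondition_iff`).

Restriction to the support loses nothing: a multiplier with a unique and extremal solution has full
support (`suppSpace_eq_top`), so weak coincidence with it is coincidence with `Θ` restricted to its
support. Pure contractivity of `Θ(z)` is automatic, because `D_δ` is injective. -/

noncomputable section

set_option linter.unusedSectionVars false

open ContinuousLinearMap
open scoped InnerProduct

/-! ### Operators determined by Gram matrices -/

section Gram

variable {ι A C F : Type*}
  [NormedAddCommGroup A] [InnerProductSpace ℂ A]
  [NormedAddCommGroup C] [InnerProductSpace ℂ C]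
  [NormedAddCommGroup F] [InnerProductSpace ℂ F]

theorem inner_linearCombination (a : ι → A) (l m : ι →₀ ℂ) :
    ⟪Finsupp.linearCombination ℂ a l, Finsupp.linearCombination ℂ a m⟫_ℂ
      = l.sum fun i s => m.sum fun j t => starRingEnd ℂ s * t * ⟪a i, a j⟫_ℂ := by
  simp only [Finsupp.linearCombination_apply, Finsupp.sum, sum_inner, inner_sum,
    inner_smul_left, inner_smul_right, Finset.mul_sum]
  rw [Finset.sum_comm]
  exact Finset.sum_congr rfl fun i _ => Finset.sum_congr rfl fun j _ => by ring

theorem norm_sq_linearCombination_add {a : ι → A} {c : ι → C} {f : ι → F}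
    (h : ∀ i j, ⟪a i, a j⟫_ℂ = ⟪c i, c j⟫_ℂ + ⟪f i, f j⟫_ℂ) (l : ι →₀ ℂ) :
    ‖Finsupp.linearCombination ℂ a l‖ ^ 2
      = ‖Finsupp.linearCombination ℂ c l‖ ^ 2 + ‖Finsupp.linearCombination ℂ f l‖ ^ 2 := by
  have key : ⟪Finsupp.linearCombination ℂ a l, Finsupp.linearCombination ℂ a l⟫_ℂ
      = ⟪Finsupp.linearCombination ℂ c l, Finsupp.linearCombination ℂ c l⟫_ℂ
        + ⟪Finsupp.linearCombination ℂ f l, Finsupp.linearCombination ℂ f l⟫_ℂ := by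
    simp only [inner_linearCombination, h, Finsupp.sum, mul_add, Finset.sum_add_distrib]
  simp only [inner_self_eq_norm_sq_to_K] at key
  exact_mod_cast key

theorem denseRange_linearCombination {a : ι → A}
    (ha : (Submodule.span ℂ (Set.range a)).topologicalClosure = ⊤) :
    DenseRange (Finsupp.linearCombination ℂ a) := by
  rw [← Finsupp.range_linearCombination, ← Submodule.dense_iff_topologicalClosure_eq_top] at ha
  simpa only [DenseRange, LinearMap.coe_range] using ha

/-- A family whose Gram matrix dominates that of another family maps onto it by a contraction. -/
theorem exists_contraction_of_gram [CompleteSpace C] {a : ι → A} {c : ι → C} {f : ι → F}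
    (ha : (Submodule.span ℂ (Set.range a)).topologicalClosure = ⊤)
    (h : ∀ i j, ⟪a i, a j⟫_ℂ = ⟪c i, c j⟫_ℂ + ⟪f i, f j⟫_ℂ) :
    ∃ M : A →L[ℂ] C, ‖M‖ ≤ 1 ∧ ∀ i, M (a i) = c i := by
  have hd := denseRange_linearCombination ha
  have hb (l : ι →₀ ℂ) : ‖Finsupp.linearCombination ℂ c l‖
      ≤ 1 * ‖Finsupp.linearCombination ℂ a l‖ := by
    rw [one_mul]
    refine (sq_le_sq₀ (norm_nonneg _) (norm_nonneg _)).1 ?_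
    rw [norm_sq_linearCombination_add h]
    exact le_add_of_nonneg_right (sq_nonneg _)
  refine ⟨(Finsupp.linearCombination ℂ c).extendOfNorm (Finsupp.linearCombination ℂ a),
    LinearMap.opNorm_extendOfNorm_le hd zero_le_one hb, fun i => ?_⟩
  simpa using LinearMap.extendOfNorm_eq hd ⟨1, hb⟩ (Finsupp.single i 1)

/-- Two total families with the same Gram matrix are unitarily equivalent. -/
theorem exists_unitary_of_gram [CompleteSpace A] [CompleteSpace C] {a : ι → A} {c : ι → C}
    (ha : (Submodule.span ℂ (Set.range a)).topologicalClosure = ⊤)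
    (hc : (Submodule.span ℂ (Set.range c)).topologicalClosure = ⊤)
    (h : ∀ i j, ⟪a i, a j⟫_ℂ = ⟪c i, c j⟫_ℂ) :
    ∃ U : A ≃ₗᵢ[ℂ] C, ∀ i, U (a i) = c i := by
  have hn (l : ι →₀ ℂ) : ‖Finsupp.linearCombination ℂ c (LinearEquiv.refl ℂ (ι →₀ ℂ) l)‖
      = ‖Finsupp.linearCombination ℂ a l‖ := by
    have := norm_sq_linearCombination_add (f := fun _ => (0 : C)) (a := a) (c := c)
      (by simpa using h) l
    have h0 : Finsupp.linearCombination ℂ (fun _ => (0 : C)) l = 0 := by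
      simp [Finsupp.linearCombination_apply]
    rw [h0, norm_zero] at this
    simp only [LinearEquiv.refl_apply]
    exact (pow_left_inj₀ (norm_nonneg _) (norm_nonneg _) two_ne_zero).1 (by linarith)
  refine ⟨(LinearEquiv.refl ℂ (ι →₀ ℂ)).extendOfIsometry _ _ (denseRange_linearCombination ha)
    (denseRange_linearCombination hc) hn, fun i => ?_⟩
  simpa using LinearEquiv.extendOfIsometry_eq (LinearEquiv.refl ℂ (ι →₀ ℂ)) _ _
    (denseRange_linearCombination ha) (denseRange_linearCombination hc) hn (Finsupp.single i 1)

end Gram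

/-! ### Defect operators and their intertwining relations -/

section Defect

variable {J K : Type*} [NormedAddCommGroup J] [InnerProductSpace ℂ J] [CompleteSpace J]
  [NormedAddCommGroup K] [InnerProductSpace ℂ K] [CompleteSpace K]

theorem ContinuousLinearMap.eq_zero_of_adjoint_comp_self {A : J →L[ℂ] K} (h : A† ∘L A = 0) :
    A = 0 := by
  have := A.norm_adjoint_comp_self
  rw [h, norm_zero] at this
  exact norm_eq_zero.1 (mul_self_eq_zero.1 this.symm)

/-- If `P² X = X Q²` with `P, Q ≥ 0`, then `P X = X Q`. -/
theorem intertwine_of_sq {P : K →L[ℂ] K} {Q : J →L[ℂ] J} (hP : 0 ≤ P) (hQ : 0 ≤ Q)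
    {X : J →L[ℂ] K} (h : P ∘L P ∘L X = X ∘L Q ∘L Q) : P ∘L X = X ∘L Q := by
  have hPa : P† = P := (IsSelfAdjoint.of_nonneg hP).adjoint_eq
  have hQa : Q† = Q := (IsSelfAdjoint.of_nonneg hQ).adjoint_eq
  set Y : J →L[ℂ] K := P ∘L X - X ∘L Q with hY
  -- The plan is to show `Y = 0`. By this anticommutation `Y* Y Q = -Y* P Y` is self-adjoint and `≤
  -- 0`; self-adjointness makes `Y* Y` and `Q` commute, so the product is also `≥ 0`.
  have h1 : P ∘L Y = -(Y ∘L Q) := by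
    rw [hY, comp_sub, h, sub_comp]
    simp only [comp_assoc, neg_sub]
  have hN : 0 ≤ Y† ∘L P ∘L Y := by
    rw [nonneg_iff_isPositive] at hP ⊢
    exact hP.adjoint_conj Y
  have hA : 0 ≤ Y† ∘L Y := by
    rw [nonneg_iff_isPositive]
    exact isPositive_adjoint_comp_self Y
  have h2 : (Y† ∘L Y) * Q = -(Y† ∘L P ∘L Y) := by
    rw [h1, comp_neg, neg_neg]; rfl
  have hcomm : Commute (Y† ∘L Y) Q := by
    have h3 := congrArg adjoint h2
    have h4 : (Y† ∘L P ∘L Y)† = Y† ∘L P ∘L Y := (IsSelfAdjoint.of_nonneg hN).adjoint_eq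
    rw [map_neg, h4, ← h2] at h3
    have h5 : ((Y† ∘L Y) * Q)† = Q * (Y† ∘L Y) := by
      change ((Y† ∘L Y) ∘L Q)† = _
      rw [adjoint_comp, adjoint_comp, adjoint_adjoint, hQa]; rfl
    rw [h5] at h3
    exact h3.symm
  have h6 : (Y† ∘L Y) * Q = 0 := by
    refine le_antisymm ?_ (hcomm.mul_nonneg hA hQ)
    rw [h2]; exact neg_nonpos.2 hN
  have h7 : Y ∘L Q = 0 := by
    refine eq_zero_of_adjoint_comp_self ?_
    rw [adjoint_comp]
    change Q† ∘L ((Y† ∘L Y) * Q) = 0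
    rw [h6, comp_zero]
  have h8 : Y† ∘L P = 0 := by
    have := congrArg adjoint h1
    rwa [h7, neg_zero, map_zero, adjoint_comp, hPa] at this
  have h9 : Q ∘L Y† = 0 := by
    have := congrArg adjoint h7
    rwa [map_zero, adjoint_comp, hQa] at this
  -- `P` and `Q` need not be injective, so `Y Q = 0` and `Y* P = 0` do not give `Y = 0` at once;
  -- expanding one factor of `Y* Y` does.
  have h10 : Y† ∘L Y = -(Y† ∘L X ∘L Q) := by
    nth_rw 2 [hY]
    rw [comp_sub, ← comp_assoc, h8, zero_comp, zero_sub]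
  have h11 : (Y† ∘L Y) ∘L Y† = 0 := by
    rw [h10, neg_comp, comp_assoc, comp_assoc, h9, comp_zero, comp_zero, neg_zero]
  have h12 : Y ∘L Y† = 0 := by
    refine eq_zero_of_adjoint_comp_self ?_
    rw [adjoint_comp, adjoint_adjoint, comp_assoc, ← comp_assoc (Y†), h11, comp_zero]
  have h13 : Y† = 0 := eq_zero_of_adjoint_comp_self (by rwa [adjoint_adjoint])
  have h14 : Y = 0 := by rw [← adjoint_adjoint Y, h13, map_zero]
  exact sub_eq_zero.1 h14

theorem one_sub_adjoint_comp_self_nonneg {A : J →L[ℂ] K} (hA : ‖A‖ ≤ 1) :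
    0 ≤ 1 - A† ∘L A := by
  rw [nonneg_iff_isPositive, isPositive_def']
  refine ⟨(IsSelfAdjoint.one _).sub (isPositive_adjoint_comp_self A).isSelfAdjoint, fun x => ?_⟩
  rw [reApplyInnerSelf_apply, sub_apply, inner_sub_left, comp_apply, adjoint_inner_left]
  change 0 ≤ RCLike.re (⟪x, x⟫_ℂ - ⟪A x, A x⟫_ℂ)
  simp only [map_sub, inner_self_eq_norm_sq, sub_nonneg]
  have : ‖A x‖ ≤ ‖x‖ := (A.le_opNorm x).trans (mul_le_of_le_one_left (norm_nonneg _) hA)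
  gcongr

theorem defectOp_nonneg (A : J →L[ℂ] K) : 0 ≤ defectOp A := CFC.sqrt_nonneg _

theorem adjoint_defectOp (A : J →L[ℂ] K) : (defectOp A)† = defectOp A :=
  (IsSelfAdjoint.of_nonneg (defectOp_nonneg A)).adjoint_eq

theorem defectOp_comp_self {A : J →L[ℂ] K} (hA : ‖A‖ ≤ 1) :
    defectOp A ∘L defectOp A = 1 - A† ∘L A :=
  CFC.sqrt_mul_sqrt_self _ (one_sub_adjoint_comp_self_nonneg hA)

theorem eq_defectOp {A : J →L[ℂ] K} {D : J →L[ℂ] J} (hD : 0 ≤ D)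
    (h : D ∘L D = 1 - A† ∘L A) : defectOp A = D :=
  CFC.sqrt_unique h hD

theorem norm_adjoint_le_one {A : J →L[ℂ] K} (hA : ‖A‖ ≤ 1) : ‖A†‖ ≤ 1 := by
  rwa [LinearIsometryEquiv.norm_map]

/-- `D_{A*} A = A D_A`. -/
theorem defectOp_adjoint_comp {A : J →L[ℂ] K} (hA : ‖A‖ ≤ 1) :
    defectOp (A†) ∘L A = A ∘L defectOp A := by
  refine intertwine_of_sq (defectOp_nonneg _) (defectOp_nonneg _) ?_
  rw [← comp_assoc, defectOp_comp_self (norm_adjoint_le_one hA), defectOp_comp_self hA]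
  ext x
  simp

theorem defectOp_comp_adjoint {A : J →L[ℂ] K} (hA : ‖A‖ ≤ 1) :
    defectOp A ∘L A† = A† ∘L defectOp (A†) := by
  have := congrArg adjoint (defectOp_adjoint_comp hA)
  rw [adjoint_comp, adjoint_comp, adjoint_defectOp, adjoint_defectOp] at this
  exact this.symm

theorem norm_sq_defectOp {A : J →L[ℂ] K} (hA : ‖A‖ ≤ 1) (x : J) :
    ‖defectOp A x‖ ^ 2 = ‖x‖ ^ 2 - ‖A x‖ ^ 2 := by
  have h := congrArg (fun B : J →L[ℂ] J => RCLike.re ⟪B x, x⟫_ℂ) (defectOp_comp_self hA)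
  simp only [comp_apply, sub_apply, inner_sub_left, adjoint_inner_left, map_sub] at h
  change _ = RCLike.re ⟪x, x⟫_ℂ - _ at h
  rw [← adjoint_defectOp, adjoint_inner_left, adjoint_defectOp] at h
  simpa only [inner_self_eq_norm_sq] using h

end Defect

/-! ### Row and column operators, resolvents -/

section Row

variable {d : ℕ} {H K : Type*} [NormedAddCommGroup H] [InnerProductSpace ℂ H]
  [NormedAddCommGroup K] [InnerProductSpace ℂ K]

@[simp]
theorem starCol_apply (z : UBall d) (h : H) (j : Fin d) :
    starCol H z h j = starRingEnd ℂ (z.1 j) • h := rfl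

@[simp]
theorem ampOp_apply (A : H →L[ℂ] K) (x : Amp d H) (j : Fin d) : ampOp d A x j = A (x j) := rfl

@[simp]
theorem rowOp_apply (z : UBall d) (x : Amp d H) : rowOp H z x = ∑ j, z.1 j • x j := by
  simp [rowOp, sum_apply]

theorem inner_starCol (z w : UBall d) (h k : H) :
    ⟪starCol H z h, starCol H w k⟫_ℂ = UBall.dot z w * ⟪h, k⟫_ℂ := by
  simp only [PiLp.inner_apply, starCol_apply, inner_smul_left, inner_smul_right, UBall.dot,
    RCLike.inner_apply, Complex.conj_conj, Finset.sum_mul]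
  exact Finset.sum_congr rfl fun j _ => by ring

theorem norm_starCol_apply (z : UBall d) (h : H) : ‖starCol H z h‖ = ‖z.1‖ * ‖h‖ := by
  have h1 := inner_starCol z z h h
  rw [UBall.dot, inner_self_eq_norm_sq_to_K, inner_self_eq_norm_sq_to_K,
    inner_self_eq_norm_sq_to_K, ← mul_pow] at h1
  norm_cast at h1
  exact (pow_left_inj₀ (norm_nonneg _) (by positivity) two_ne_zero).1 (by exact_mod_cast h1)

theorem UBall.norm_lt_one (z : UBall d) : ‖z.1‖ < 1 := mem_ball_zero_iff.1 z.2

theorem norm_starCol_le (z : UBall d) : ‖starCol H z‖ ≤ ‖z.1‖ :=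
  opNorm_le_bound _ (norm_nonneg _) fun h => (norm_starCol_apply z h).le

theorem starCol_zero : starCol H (UBall.zero d) = 0 := by
  ext h j
  simp [UBall.zero]

theorem rowOp_zero : rowOp H (UBall.zero d) = 0 := by
  ext h
  simp [UBall.zero]

theorem rowOp_comp_ampOp (A : H →L[ℂ] K) (z : UBall d) :
    rowOp K z ∘L ampOp d A = A ∘L rowOp H z := by
  ext x
  simp

variable [CompleteSpace H] [CompleteSpace K]

theorem adjoint_starCol (z : UBall d) : (starCol H z)† = rowOp H z := by
  symm
  rw [eq_adjoint_iff]
  intro x h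
  simp [PiLp.inner_apply, sum_inner, inner_smul_left, inner_smul_right]

theorem adjoint_rowOp (z : UBall d) : (rowOp H z)† = starCol H z := by
  rw [← adjoint_starCol, adjoint_adjoint]

theorem norm_rowOp_apply_le (z : UBall d) (x : Amp d H) : ‖rowOp H z x‖ ≤ ‖z.1‖ * ‖x‖ := by
  refine (le_opNorm _ _).trans ?_
  gcongr
  rw [← adjoint_starCol, LinearIsometryEquiv.norm_map]
  exact norm_starCol_le z

theorem isUnit_one_sub_comp_starCol {T : Amp d H →L[ℂ] H} (hT : ‖T‖ ≤ 1) (z : UBall d) :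
    IsUnit (1 - T ∘L starCol H z) := by
  refine isUnit_one_sub_of_norm_lt_one ?_
  calc ‖T ∘L starCol H z‖ ≤ ‖T‖ * ‖starCol H z‖ := opNorm_comp_le _ _
    _ ≤ 1 * ‖z.1‖ := by gcongr; exact norm_starCol_le z
    _ < 1 := by rw [one_mul]; exact z.norm_lt_one

theorem comp_resolv {T : Amp d H →L[ℂ] H} (hT : ‖T‖ ≤ 1) (z : UBall d) :
    (1 - T ∘L starCol H z) ∘L resolv T z = 1 :=
  Ring.mul_inverse_cancel _ (isUnit_one_sub_comp_starCol hT z)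

theorem resolv_comp {T : Amp d H →L[ℂ] H} (hT : ‖T‖ ≤ 1) (z : UBall d) :
    resolv T z ∘L (1 - T ∘L starCol H z) = 1 :=
  Ring.inverse_mul_cancel _ (isUnit_one_sub_comp_starCol hT z)

theorem resolv_apply_eq {T : Amp d H →L[ℂ] H} (hT : ‖T‖ ≤ 1) (z : UBall d) (h : H) :
    resolv T z h = h + T (starCol H z (resolv T z h)) := by
  have := congrArg (fun A : H →L[ℂ] H => A h) (comp_resolv hT z)
  change resolv T z h - T (starCol H z (resolv T z h)) = h at this
  exact sub_eq_iff_eq_add.1 this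

theorem adjoint_one_sub_comp_starCol (T : Amp d H →L[ℂ] H) (z : UBall d) :
    (1 - T ∘L starCol H z)† = 1 - rowOp H z ∘L T† := by
  rw [map_sub, adjoint_comp, adjoint_starCol]
  congr 1
  exact adjoint_id

theorem adjoint_resolv_comp {T : Amp d H →L[ℂ] H} (hT : ‖T‖ ≤ 1) (z : UBall d) :
    (resolv T z)† ∘L (1 - rowOp H z ∘L T†) = 1 := by
  rw [← adjoint_one_sub_comp_starCol, ← adjoint_comp, comp_resolv hT]
  exact adjoint_id

theorem comp_adjoint_resolv {T : Amp d H →L[ℂ] H} (hT : ‖T‖ ≤ 1) (z : UBall d) :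
    (1 - rowOp H z ∘L T†) ∘L (resolv T z)† = 1 := by
  rw [← adjoint_one_sub_comp_starCol, ← adjoint_comp, resolv_comp hT]
  exact adjoint_id

theorem adjoint_resolv_apply_eq {T : Amp d H →L[ℂ] H} (hT : ‖T‖ ≤ 1) (z : UBall d) (h : H) :
    ((resolv T z)†) h = h + rowOp H z ((T†) (((resolv T z)†) h)) := by
  have := congrArg (fun A : H →L[ℂ] H => A h) (comp_adjoint_resolv hT z)
  change ((resolv T z)†) h - rowOp H z ((T†) (((resolv T z)†) h)) = h at this
  exact sub_eq_iff_eq_add.1 this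

end Row

/-! ### Defect models of a contraction and the Julia operator -/

/-- Coordinates for the defect spaces of a contraction `T`: isometries `src`, `tgt` onto the
closures of the ranges of `D_T`, `D_{T*}`, with `δ` the compression of `-T` to these spaces. -/
structure DefectModel {E H : Type*} [NormedAddCommGroup E] [InnerProductSpace ℂ E]
    [CompleteSpace E] [NormedAddCommGroup H] [InnerProductSpace ℂ H] [CompleteSpace H]
    (T : E →L[ℂ] H) (J K : Type*) [NormedAddCommGroup J] [InnerProductSpace ℂ J]
    [CompleteSpace J] [NormedAddCommGroup K] [InnerProductSpace ℂ K] [CompleteSpace K] where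
  src : J →L[ℂ] E
  tgt : K →L[ℂ] H
  δ : J →L[ℂ] K
  src_isometry : src† ∘L src = 1
  tgt_isometry : tgt† ∘L tgt = 1
  comp_src : T ∘L src = -(tgt ∘L δ)
  adjoint_comp_tgt : T† ∘L tgt = -(src ∘L δ†)
  defect : 1 - T† ∘L T = src ∘L (1 - δ† ∘L δ) ∘L src†
  codefect : 1 - T ∘L T† = tgt ∘L (1 - δ ∘L δ†) ∘L tgt†

namespace DefectModel

section General

variable {E H J K : Type*} [NormedAddCommGroup E] [InnerProductSpace ℂ E]
  [CompleteSpace E] [NormedAddCommGroup H] [InnerProductSpace ℂ H] [CompleteSpace H]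
  [NormedAddCommGroup J] [InnerProductSpace ℂ J]
  [CompleteSpace J] [NormedAddCommGroup K] [InnerProductSpace ℂ K] [CompleteSpace K]
  {T : E →L[ℂ] H} (m : DefectModel T J K)

theorem src_apply (g : J) : (m.src†) (m.src g) = g :=
  congrArg (fun A : J →L[ℂ] J => A g) m.src_isometry

theorem tgt_apply (g : K) : (m.tgt†) (m.tgt g) = g :=
  congrArg (fun A : K →L[ℂ] K => A g) m.tgt_isometry

theorem inner_src (g h : J) : ⟪m.src g, m.src h⟫_ℂ = ⟪g, h⟫_ℂ := by
  rw [← adjoint_inner_right, src_apply]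

theorem inner_tgt (g h : K) : ⟪m.tgt g, m.tgt h⟫_ℂ = ⟪g, h⟫_ℂ := by
  rw [← adjoint_inner_right, tgt_apply]

theorem norm_src (g : J) : ‖m.src g‖ = ‖g‖ := by
  rw [@norm_eq_sqrt_re_inner ℂ, m.inner_src, ← @norm_eq_sqrt_re_inner ℂ]

theorem norm_tgt (g : K) : ‖m.tgt g‖ = ‖g‖ := by
  rw [@norm_eq_sqrt_re_inner ℂ, m.inner_tgt, ← @norm_eq_sqrt_re_inner ℂ]

theorem T_src (g : J) : T (m.src g) = -m.tgt (m.δ g) :=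
  congrArg (fun A : J →L[ℂ] H => A g) m.comp_src

theorem adjoint_T_tgt (g : K) : (T†) (m.tgt g) = -m.src ((m.δ†) g) :=
  congrArg (fun A : K →L[ℂ] E => A g) m.adjoint_comp_tgt

/-- The model of the adjoint. -/
def symm : DefectModel (T†) K J where
  src := m.tgt
  tgt := m.src
  δ := m.δ†
  src_isometry := m.tgt_isometry
  tgt_isometry := m.src_isometry
  comp_src := m.adjoint_comp_tgt
  adjoint_comp_tgt := by simpa only [adjoint_adjoint] using m.comp_src
  defect := by simpa only [adjoint_adjoint] using m.codefect
  codefect := by simpa only [adjoint_adjoint] using m.defect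

theorem norm_δ_le (hT : ‖T‖ ≤ 1) : ‖m.δ‖ ≤ 1 := by
  refine opNorm_le_bound _ zero_le_one fun g => ?_
  rw [← m.norm_tgt, ← norm_neg, ← m.T_src, one_mul, ← m.norm_src g]
  exact (T.le_opNorm _).trans (mul_le_of_le_one_left (norm_nonneg _) hT)

/-- Uniqueness of the positive square root: since `src` is isometric, the right side squares to `src
(1 - δ* δ) src*`. -/
theorem defectOp_eq (hT : ‖T‖ ≤ 1) : defectOp T = m.src ∘L defectOp m.δ ∘L m.src† := by
  refine eq_defectOp ?_ ?_
  · have h := defectOp_nonneg m.δ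
    rw [nonneg_iff_isPositive] at h ⊢
    exact h.conj_adjoint m.src
  · rw [m.defect, ← defectOp_comp_self (m.norm_δ_le hT)]
    ext x
    simp [m.src_apply]

theorem defectOp_adjoint_eq (hT : ‖T‖ ≤ 1) :
    defectOp (T†) = m.tgt ∘L defectOp (m.δ†) ∘L m.tgt† :=
  m.symm.defectOp_eq (norm_adjoint_le_one hT)

theorem inner_defect (hT : ‖T‖ ≤ 1) (x y : E) :
    ⟪defectOp m.δ ((m.src†) x), defectOp m.δ ((m.src†) y)⟫_ℂ = ⟪x, y⟫_ℂ - ⟪T x, T y⟫_ℂ := by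
  have h := congrArg (fun A : E →L[ℂ] E => ⟪A x, y⟫_ℂ) m.defect
  rw [← defectOp_comp_self (m.norm_δ_le hT)] at h
  simp only [comp_apply, sub_apply, inner_sub_left, adjoint_inner_left] at h
  rw [← adjoint_inner_right m.src] at h
  conv_rhs at h => rw [← adjoint_defectOp, adjoint_inner_left, adjoint_defectOp]
  rw [← h]
  rfl

/-- The Julia operator of a contraction is isometric. -/
theorem inner_julia (hT : ‖T‖ ≤ 1) (x y : E) (u v : K) :
    ⟪T x + m.tgt (defectOp (m.δ†) u), T y + m.tgt (defectOp (m.δ†) v)⟫_ℂ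
      + ⟪(m.δ†) u + defectOp m.δ ((m.src†) x), (m.δ†) v + defectOp m.δ ((m.src†) y)⟫_ℂ
      = ⟪x, y⟫_ℂ + ⟪u, v⟫_ℂ := by
  -- The mixed terms of the two inner products cancel, by `D_δ δ* = δ* D_{δ*}`.
  have hcross (x : E) (v : K) : ⟪T x, m.tgt (defectOp (m.δ†) v)⟫_ℂ
      = -⟪defectOp m.δ ((m.src†) x), (m.δ†) v⟫_ℂ := by
    rw [← adjoint_inner_right, m.adjoint_T_tgt, inner_neg_right]
    have := congrArg (fun A : K →L[ℂ] J => A v) (defectOp_comp_adjoint (m.norm_δ_le hT))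
    simp only [comp_apply] at this
    rw [← this, ← adjoint_inner_left, ← adjoint_inner_left, adjoint_defectOp]
  have hcross' (u : K) (y : E) : ⟪m.tgt (defectOp (m.δ†) u), T y⟫_ℂ
      = -⟪(m.δ†) u, defectOp m.δ ((m.src†) y)⟫_ℂ := by
    rw [← inner_conj_symm, hcross, map_neg, inner_conj_symm]
  have h1 := m.inner_defect hT x y
  have h2 : ⟪defectOp (m.δ†) u, defectOp (m.δ†) v⟫_ℂ = ⟪u, v⟫_ℂ - ⟪(m.δ†) u, (m.δ†) v⟫_ℂ := by
    have h := congrArg (fun A : K →L[ℂ] K => ⟪A u, v⟫_ℂ)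
      (defectOp_comp_self (norm_adjoint_le_one (m.norm_δ_le hT)))
    simp only [comp_apply, sub_apply, inner_sub_left, adjoint_adjoint] at h
    conv_lhs at h => rw [← adjoint_defectOp, adjoint_inner_left, adjoint_defectOp]
    rw [h, ← adjoint_inner_right m.δ]
    rfl
  simp only [inner_add_left, inner_add_right, m.inner_tgt, hcross, hcross', h1, h2]
  ring

end General

end DefectModel

/-! ### The transfer function of a row contraction and its Frostman shift -/

namespace DefectModel

section RowContraction

variable {d : ℕ} {H J K : Type*} [NormedAddCommGroup H] [InnerProductSpace ℂ H] [CompleteSpace H]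
  [NormedAddCommGroup J] [InnerProductSpace ℂ J]
  [CompleteSpace J] [NormedAddCommGroup K] [InnerProductSpace ℂ K] [CompleteSpace K]
  {T : Amp d H →L[ℂ] H} (m : DefectModel T J K)

/-- `(I - T z*)⁻¹ D_{T*}` in the coordinates of the model. -/
def kerVec (z : UBall d) : K →L[ℂ] H := resolv T z ∘L m.tgt ∘L defectOp (m.δ†)

/-- The Sz.-Nagy–Foias transfer function `-T + D_{T*} (I - z T*)⁻¹ z D_T` in the coordinates
of the model. -/
def transfer (z : UBall d) : J →L[ℂ] K :=
  m.δ + (m.kerVec z)† ∘L rowOp H z ∘L m.src ∘L defectOp m.δ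

theorem transfer_zero : m.transfer (UBall.zero d) = m.δ := by
  simp [transfer, rowOp_zero]

theorem transfer_apply (z : UBall d) (g : J) :
    m.transfer z g = m.δ g + ((m.kerVec z)†) (rowOp H z (m.src (defectOp m.δ g))) := rfl

theorem adjoint_transfer_apply (z : UBall d) (u : K) :
    ((m.transfer z)†) u
      = (m.δ†) u + defectOp m.δ ((m.src†) (starCol H z (m.kerVec z u))) := by
  simp only [transfer, map_add, adjoint_comp, adjoint_adjoint, adjoint_rowOp, adjoint_defectOp]
  rfl

theorem kerVec_eq (hT : ‖T‖ ≤ 1) (z : UBall d) (u : K) :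
    m.kerVec z u = T (starCol H z (m.kerVec z u)) + m.tgt (defectOp (m.δ†) u) := by
  rw [add_comm]
  exact resolv_apply_eq hT z _

/-- The Julia operator sends `(z* K(z) u, u)` to `(K(z) u, Θ(z)* u)`; isometry, with `⟪z* h, w* k⟫ =
(z w*) ⟪h, k⟫`, gives the factorization of the de Branges–Rovnyak kernel. -/
theorem inner_kerVec (hT : ‖T‖ ≤ 1) (z w : UBall d) (u v : K) :
    (1 - UBall.dot z w) * ⟪m.kerVec z u, m.kerVec w v⟫_ℂ
      = ⟪u, v⟫_ℂ - ⟪((m.transfer z)†) u, ((m.transfer w)†) v⟫_ℂ := by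
  have h := m.inner_julia hT (starCol H z (m.kerVec z u)) (starCol H w (m.kerVec w v)) u v
  rw [← m.kerVec_eq hT, ← m.kerVec_eq hT, ← adjoint_transfer_apply, ← adjoint_transfer_apply,
    inner_starCol] at h
  linear_combination h

/-- `D_T Θ(z)* = (z* - T*) (I - T z*)⁻¹ D_{T*}`. -/
theorem src_defectOp_adjoint_transfer (hT : ‖T‖ ≤ 1) (z : UBall d) (u : K) :
    m.src (defectOp m.δ (((m.transfer z)†) u))
      = starCol H z (m.kerVec z u) - (T†) (m.kerVec z u) := by
  have h1 : m.src (defectOp m.δ (defectOp m.δ ((m.src†) (starCol H z (m.kerVec z u)))))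
      = starCol H z (m.kerVec z u) - (T†) (T (starCol H z (m.kerVec z u))) := by
    have h := congrArg (fun A : Amp d H →L[ℂ] Amp d H => A (starCol H z (m.kerVec z u))) m.defect
    rw [← defectOp_comp_self (m.norm_δ_le hT)] at h
    exact h.symm
  have h2 : defectOp m.δ ((m.δ†) u) = (m.δ†) (defectOp (m.δ†) u) :=
    congrArg (fun A : K →L[ℂ] J => A u) (defectOp_comp_adjoint (m.norm_δ_le hT))
  have h3 : (T†) (m.kerVec z u) = (T†) (T (starCol H z (m.kerVec z u)))
      - m.src ((m.δ†) (defectOp (m.δ†) u)) := by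
    conv_lhs => rw [m.kerVec_eq hT, map_add, m.adjoint_T_tgt, ← sub_eq_add_neg]
  rw [adjoint_transfer_apply, map_add, map_add, h1, h2, h3]
  abel

/-- The transfer function is purely contractive as soon as its value at `0` is. -/
theorem isPureContraction_transfer (hT : ‖T‖ ≤ 1) (hδ : ∀ g, defectOp m.δ g = 0 → g = 0)
    (z : UBall d) : IsPureContraction (m.transfer z) := by
  intro g hg
  by_contra! hle
  set h : H := ((resolv T z)†) (rowOp H z (m.src (defectOp m.δ g))) with hh
  set x : Amp d H := (T†) h + m.src (defectOp m.δ g) with hx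
  have h1 : h = rowOp H z x := by
    have := adjoint_resolv_apply_eq hT z (rowOp H z (m.src (defectOp m.δ g)))
    rw [← hh] at this
    rw [hx, map_add, add_comm, ← this]
  have h2 : m.transfer z g = m.δ g + defectOp (m.δ†) ((m.tgt†) h) := by
    rw [transfer_apply, kerVec, adjoint_comp, adjoint_comp, adjoint_defectOp]
    rfl
  -- The Julia operator of `T*` sends `(h, g)` to `(x, Θ(z) g)`. If `‖Θ(z) g‖ ≥ ‖g‖`, then `‖x‖ ≤
  -- ‖h‖ = ‖z x‖ ≤ ‖z‖ ‖x‖`, so `x = 0` because `‖z‖ < 1`.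
  have h3 := m.symm.inner_julia (norm_adjoint_le_one hT) h h g g
  simp only [symm, adjoint_adjoint, ← h2, ← hx, inner_self_eq_norm_sq_to_K] at h3
  norm_cast at h3
  have h4 : ‖h‖ ≤ ‖z.1‖ * ‖x‖ := by
    rw [h1]; exact norm_rowOp_apply_le z x
  have h5 : ‖x‖ ≤ ‖h‖ := by
    refine (sq_le_sq₀ (norm_nonneg _) (norm_nonneg _)).1 ?_
    have := pow_le_pow_left₀ (norm_nonneg g) hle 2
    linarith
  have h6 : x = 0 := by
    rw [← norm_eq_zero]
    have := z.norm_lt_one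
    nlinarith [norm_nonneg x]
  rw [h6, map_zero] at h1
  rw [h1, map_zero, zero_add] at hx
  refine hg (hδ g ?_)
  rw [← norm_eq_zero, ← m.norm_src, ← hx, h6, norm_zero]

/-- The partial isometry `V` in the isometric-pure decomposition of `T`. -/
def isom : Amp d H →L[ℂ] H := T + m.tgt ∘L m.δ ∘L m.src†

theorem adjoint_isom : m.isom† = T† + m.src ∘L m.δ† ∘L m.tgt† := by
  simp [isom, adjoint_comp, comp_assoc]

theorem adjoint_src_adjoint_isom (h : H) : (m.src†) ((m.isom†) h) = 0 := by
  refine ext_inner_right ℂ fun g => ?_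
  rw [adjoint_inner_left, adjoint_inner_left, isom]
  simp [m.T_src, m.src_apply]

/-- `T* h` is the orthogonal difference of `V* h` and `src δ* tgt* h`; together with the codefect
identity this gives `I - V V* = tgt tgt*` in norm form. -/
theorem norm_sq_adjoint_isom (h : H) : ‖(m.isom†) h‖ ^ 2 = ‖h‖ ^ 2 - ‖(m.tgt†) h‖ ^ 2 := by
  have h1 := congrArg (fun A : H →L[ℂ] H => ⟪A h, h⟫_ℂ) m.codefect
  simp only [comp_apply, sub_apply, inner_sub_left, map_sub] at h1
  change ⟪h, h⟫_ℂ - ⟪T ((T†) h), h⟫_ℂ = ⟪m.tgt ((m.tgt†) h), h⟫_ℂ - _ at h1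
  rw [← adjoint_inner_right m.tgt, ← adjoint_inner_right m.tgt, ← adjoint_inner_right T,
    ← adjoint_inner_right m.δ] at h1
  have h2 : ⟪(m.isom†) h, (m.isom†) h⟫_ℂ
      = ⟪(T†) h, (T†) h⟫_ℂ - ⟪(m.δ†) ((m.tgt†) h), (m.δ†) ((m.tgt†) h)⟫_ℂ := by
    have h3 : ⟪(m.isom†) h, m.src ((m.δ†) ((m.tgt†) h))⟫_ℂ = 0 := by
      rw [← adjoint_inner_left, adjoint_src_adjoint_isom, inner_zero_left]
    have h4 : (T†) h = (m.isom†) h - m.src ((m.δ†) ((m.tgt†) h)) := by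
      rw [adjoint_isom]; simp
    have h3' : ⟪m.src ((m.δ†) ((m.tgt†) h)), (m.isom†) h⟫_ℂ = 0 := inner_eq_zero_symm.1 h3
    rw [h4]
    simp only [inner_sub_left, inner_sub_right, m.inner_src, h3, h3']
    ring
  have h5 : ⟪(m.isom†) h, (m.isom†) h⟫_ℂ = ⟪h, h⟫_ℂ - ⟪(m.tgt†) h, (m.tgt†) h⟫_ℂ := by
    rw [h2]; linear_combination -h1
  simp only [inner_self_eq_norm_sq_to_K] at h5
  exact_mod_cast h5

theorem norm_isom_le : ‖m.isom‖ ≤ 1 := by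
  rw [← LinearIsometryEquiv.norm_map adjoint]
  refine opNorm_le_bound _ zero_le_one fun h => ?_
  rw [one_mul]
  refine (sq_le_sq₀ (norm_nonneg _) (norm_nonneg _)).1 ?_
  rw [m.norm_sq_adjoint_isom]
  exact sub_le_self _ (sq_nonneg _)

/-- The transfer function of the partial isometry `V`. -/
def isomTransfer (z : UBall d) : J →L[ℂ] K :=
  m.tgt† ∘L (resolv m.isom z)† ∘L rowOp H z ∘L m.src

/-- A Schwarz lemma. With `h = (I - z V*)⁻¹ z src g` one has `h = z (V* h + src g)`, an orthogonal
sum inside, and `‖tgt* h‖² = ‖h‖² - ‖V* h‖²`. The strict bound by `‖z‖ < 1` is what makes `I + δ*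
b_V(z)` invertible, even when `‖δ‖ = 1`. -/
theorem norm_isomTransfer_le (z : UBall d) : ‖m.isomTransfer z‖ ≤ ‖z.1‖ := by
  refine opNorm_le_bound _ (norm_nonneg _) fun g => ?_
  set h : H := ((resolv m.isom z)†) (rowOp H z (m.src g)) with hh
  have h1 : h = rowOp H z ((m.isom†) h + m.src g) := by
    have := adjoint_resolv_apply_eq m.norm_isom_le z (rowOp H z (m.src g))
    rw [← hh] at this
    rw [map_add, add_comm, ← this]
  have h2 : ‖h‖ ≤ ‖z.1‖ * ‖(m.isom†) h + m.src g‖ := by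
    conv_lhs => rw [h1]
    exact norm_rowOp_apply_le z _
  have h3 : ‖(m.isom†) h + m.src g‖ ^ 2 = ‖(m.isom†) h‖ ^ 2 + ‖g‖ ^ 2 := by
    have h4 : ⟪(m.isom†) h, m.src g⟫_ℂ = 0 := by
      rw [← adjoint_inner_left, adjoint_src_adjoint_isom, inner_zero_left]
    rw [sq, sq, norm_add_sq_eq_norm_sq_add_norm_sq_of_inner_eq_zero _ _ h4, m.norm_src, sq]
  have h5 := m.norm_sq_adjoint_isom h
  change ‖(m.tgt†) h‖ ≤ _
  refine (sq_le_sq₀ (norm_nonneg _) (by positivity)).1 ?_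
  have h6 : ‖h‖ ^ 2 ≤ ‖z.1‖ ^ 2 * (‖(m.isom†) h‖ ^ 2 + ‖g‖ ^ 2) := by
    rw [← h3, ← mul_pow]
    exact pow_le_pow_left₀ (norm_nonneg _) h2 2
  have h7 : ‖z.1‖ ^ 2 ≤ 1 := pow_le_one₀ (norm_nonneg _) z.norm_lt_one.le
  rw [mul_pow]
  nlinarith [sq_nonneg ‖(m.isom†) h‖]

theorem isUnit_frostman (hT : ‖T‖ ≤ 1) (z : UBall d) :
    IsUnit (1 + m.δ† ∘L m.isomTransfer z) := by
  rw [← sub_neg_eq_add]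
  refine isUnit_one_sub_of_norm_lt_one ?_
  rw [norm_neg]
  calc ‖m.δ† ∘L m.isomTransfer z‖ ≤ ‖m.δ†‖ * ‖m.isomTransfer z‖ := opNorm_comp_le _ _
    _ ≤ 1 * ‖z.1‖ := by
      gcongr
      · exact norm_adjoint_le_one (m.norm_δ_le hT)
      · exact m.norm_isomTransfer_le z
    _ < 1 := by rw [one_mul]; exact z.norm_lt_one

theorem frostman_aux (hT : ‖T‖ ≤ 1) (z : UBall d) :
    (m.tgt† ∘L (resolv T z)† ∘L rowOp H z ∘L m.src) ∘L (1 + m.δ† ∘L m.isomTransfer z)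
      = m.isomTransfer z := by
  ext g
  set h : H := ((resolv m.isom z)†) (rowOp H z (m.src g)) with hh
  have h1 : h = rowOp H z (m.src g) + rowOp H z ((m.isom†) h) :=
    adjoint_resolv_apply_eq m.norm_isom_le z (rowOp H z (m.src g))
  -- Here `src δ* tgt* = V* - T*` trades the resolvent of `V` for that of `T`.
  have h2 : rowOp H z (m.src (g + (m.δ†) ((m.tgt†) h))) = h - rowOp H z ((T†) h) := by
    conv_rhs => enter [1]; rw [h1]
    rw [adjoint_isom]
    simp only [map_add, add_apply, comp_apply]
    abel
  have h3 : ((resolv T z)†) (h - rowOp H z ((T†) h)) = h :=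
    congrArg (fun A : H →L[ℂ] H => A h) (adjoint_resolv_comp hT z)
  change (m.tgt†) (((resolv T z)†) (rowOp H z (m.src (g + (m.δ†) ((m.tgt†) h))))) = (m.tgt†) h
  rw [h2, h3]

/-- The transfer function of `T` is the Frostman shift of that of `V`. -/
theorem frostman (hT : ‖T‖ ≤ 1) (z : UBall d) :
    defectOp (m.δ†) ∘L m.transfer z = (m.isomTransfer z + m.δ) ∘L
      Ring.inverse (1 + m.δ† ∘L m.isomTransfer z) ∘L defectOp m.δ := by
  set E : J →L[ℂ] K := m.tgt† ∘L (resolv T z)† ∘L rowOp H z ∘L m.src with hE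
  set N := 1 + m.δ† ∘L m.isomTransfer z with hN
  have hu : N ∘L Ring.inverse N = 1 := Ring.mul_inverse_cancel _ (m.isUnit_frostman hT z)
  have h1 : E = m.isomTransfer z ∘L Ring.inverse N := by
    rw [← m.frostman_aux hT z, comp_assoc, hu]; rfl
  have h2 : m.transfer z = m.δ + defectOp (m.δ†) ∘L E ∘L defectOp m.δ := by
    rw [transfer, kerVec, adjoint_comp, adjoint_comp, adjoint_defectOp]
    rfl
  have h3 : defectOp (m.δ†) ∘L defectOp (m.δ†) = 1 - m.δ ∘L m.δ† := by
    simpa only [adjoint_adjoint] using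
      defectOp_comp_self (norm_adjoint_le_one (m.norm_δ_le hT))
  have h5 : m.δ = (m.δ ∘L N) ∘L Ring.inverse N := by rw [comp_assoc, hu]; rfl
  -- Over the common right factor `N⁻¹`, the two occurrences of `δ δ* b_V` cancel.
  have h6 : m.δ + (1 - m.δ ∘L m.δ†) ∘L E = (m.isomTransfer z + m.δ) ∘L Ring.inverse N := by
    rw [h1]
    conv_lhs => enter [1]; rw [h5]
    rw [← comp_assoc, ← add_comp, hN]
    congr 1
    ext g
    simp [add_comm]
  rw [h2, comp_add, defectOp_adjoint_comp (m.norm_δ_le hT), ← comp_assoc, h3, ← comp_assoc,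
    ← add_comp, h6, comp_assoc]

/-- Lets the factor `D_{δ*}` be cancelled in the defining equation of the characteristic function.
-/
theorem defectOp_adjoint_injective (hT : ‖T‖ ≤ 1) (hδ : ∀ g, defectOp m.δ g = 0 → g = 0)
    (u : K) (hu : defectOp (m.δ†) u = 0) : u = 0 := by
  have h1 : defectOp m.δ ((m.δ†) u) = (m.δ†) (defectOp (m.δ†) u) :=
    congrArg (fun A : K →L[ℂ] J => A u) (defectOp_comp_adjoint (m.norm_δ_le hT))
  rw [hu, map_zero] at h1
  have h2 := norm_sq_defectOp (norm_adjoint_le_one (m.norm_δ_le hT)) u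
  rw [hu, hδ _ h1] at h2
  simpa using h2.symm

theorem range_kerVec (hT : ‖T‖ ≤ 1) (z : UBall d) :
    LinearMap.range (m.kerVec z : K →ₗ[ℂ] H) = resolvDefect T z := by
  rw [resolvDefect, m.defectOp_adjoint_eq hT]
  ext h
  constructor
  · rintro ⟨u, rfl⟩
    exact ⟨_, ⟨m.tgt u, rfl⟩, by simp [kerVec, m.tgt_apply]⟩
  · rintro ⟨_, ⟨u, rfl⟩, rfl⟩
    exact ⟨(m.tgt†) u, rfl⟩

end RowContraction

end DefectModel

/-! ### The partial isometric part and its defect spaces -/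

section IsometricPart

variable {d : ℕ} {H : Type*} [NormedAddCommGroup H] [InnerProductSpace ℂ H] [CompleteSpace H]
  {T : Amp d H →L[ℂ] H}

theorem defectOp_apply_eq_zero_iff (hT : ‖T‖ ≤ 1) (x : Amp d H) :
    defectOp T x = 0 ↔ (T†) (T x) = x := by
  have h1 : defectOp T (defectOp T x) = x - (T†) (T x) :=
    congrArg (fun A : Amp d H →L[ℂ] Amp d H => A x) (defectOp_comp_self hT)
  constructor
  · intro h
    rw [h, map_zero] at h1
    exact (sub_eq_zero.1 h1.symm).symm
  · intro h
    rw [h, sub_self] at h1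
    rw [← inner_self_eq_zero (𝕜 := ℂ), ← adjoint_inner_left, adjoint_defectOp, h1, inner_zero_left]

/-- The projection onto `ker D_T`. -/
abbrev kerDefectProj (T : Amp d H →L[ℂ] H) : Amp d H →L[ℂ] Amp d H :=
  (LinearMap.ker (defectOp T : Amp d H →ₗ[ℂ] Amp d H)).starProjection

theorem adjoint_kerDefectProj : (kerDefectProj T)† = kerDefectProj T :=
  (isSelfAdjoint_starProjection _).adjoint_eq

theorem isometricPart_apply (x : Amp d H) : isometricPart T x = T (kerDefectProj T x) := rfl

theorem adjoint_T_T_kerDefectProj (hT : ‖T‖ ≤ 1) (x : Amp d H) :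
    (T†) (T (kerDefectProj T x)) = kerDefectProj T x :=
  (defectOp_apply_eq_zero_iff hT _).1
    (Submodule.starProjection_apply_mem (LinearMap.ker (defectOp T : Amp d H →ₗ[ℂ] Amp d H)) x)

theorem kerDefectProj_idem (x : Amp d H) :
    kerDefectProj T (kerDefectProj T x) = kerDefectProj T x :=
  Submodule.starProjection_eq_self_iff.2 (Submodule.starProjection_apply_mem _ x)

theorem adjoint_isometricPart_apply (h : H) :
    ((isometricPart T)†) h = kerDefectProj T ((T†) h) := by
  rw [isometricPart, adjoint_comp]
  change ((kerDefectProj T)†) _ = _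
  rw [adjoint_kerDefectProj]
  rfl

theorem adjoint_isometricPart_isometricPart (hT : ‖T‖ ≤ 1) (x : Amp d H) :
    ((isometricPart T)†) (isometricPart T x) = kerDefectProj T x := by
  rw [adjoint_isometricPart_apply, isometricPart_apply, adjoint_T_T_kerDefectProj hT,
    kerDefectProj_idem]

theorem adjoint_T_isometricPart (hT : ‖T‖ ≤ 1) (x : Amp d H) :
    (T†) (isometricPart T x) = kerDefectProj T x :=
  adjoint_T_T_kerDefectProj hT x

theorem adjoint_isometricPart_T (hT : ‖T‖ ≤ 1) (x : Amp d H) :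
    ((isometricPart T)†) (T x) = kerDefectProj T x := by
  refine ext_inner_right ℂ fun y => ?_
  rw [adjoint_inner_left, ← adjoint_inner_right, adjoint_T_isometricPart hT,
    ← adjoint_inner_left, adjoint_kerDefectProj]

theorem isometricPart_kerDefectProj (x : Amp d H) :
    isometricPart T (kerDefectProj T x) = isometricPart T x := by
  rw [isometricPart_apply, kerDefectProj_idem]; rfl

theorem norm_isometricPart_le (hT : ‖T‖ ≤ 1) : ‖isometricPart T‖ ≤ 1 := by
  refine opNorm_le_bound _ zero_le_one fun x => ?_
  rw [one_mul, isometricPart_apply]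
  refine (T.le_opNorm _).trans ((mul_le_of_le_one_left (norm_nonneg _) hT).trans ?_)
  exact Submodule.norm_starProjection_apply_le _ x

theorem isometricPart_eq_zero_iff (hT : ‖T‖ ≤ 1) (x : Amp d H) :
    isometricPart T x = 0 ↔ kerDefectProj T x = 0 := by
  constructor
  · intro h
    rw [← adjoint_isometricPart_isometricPart hT, h, map_zero]
  · intro h
    rw [isometricPart_apply, h, map_zero]

/-- Take adjoints in `(V - z) V* V` and use `V* V V* = V*`. In this form `I - V z*` visibly carries
the `z`-defect space into `ker V*`, the defect space at `0`. -/
theorem mem_defectSpace_iff (hT : ‖T‖ ≤ 1) (z : UBall d) (h : H) :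
    h ∈ defectSpace (isometricPart T) z ↔
      ((isometricPart T)†) (h - isometricPart T (starCol H z h)) = 0 := by
  rw [defectSpace, Submodule.mem_orthogonal']
  have key (x : Amp d H) : ⟪h, ((isometricPart T - rowOp H z) ∘L
      ((isometricPart T)†) ∘L isometricPart T) x⟫_ℂ
      = ⟪((isometricPart T)†) (h - isometricPart T (starCol H z h)), x⟫_ℂ := by
    simp only [comp_apply, adjoint_isometricPart_isometricPart hT, sub_apply, inner_sub_right,
      map_sub, inner_sub_left, isometricPart_kerDefectProj]
    rw [← adjoint_inner_left, ← adjoint_inner_left (rowOp H z), adjoint_rowOp,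
      ← adjoint_inner_left (kerDefectProj T), adjoint_kerDefectProj]
  constructor
  · intro hh
    refine inner_self_eq_zero (𝕜 := ℂ).1 ?_
    rw [← key]
    exact hh _ ⟨_, rfl⟩
  · rintro hh _ ⟨x, rfl⟩
    exact (key x).trans (by rw [hh, inner_zero_left])

theorem mem_defectSpace_zero_iff (hT : ‖T‖ ≤ 1) (h : H) :
    h ∈ defectSpace (isometricPart T) (UBall.zero d) ↔ ((isometricPart T)†) h = 0 := by
  rw [mem_defectSpace_iff hT, starCol_zero, zero_apply, map_zero, sub_zero]

end IsometricPart

/-! ### Model triples and the characteristic function -/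

namespace ModelTriple

variable {d : ℕ} {H Jinf Jzero : Type*}
  [NormedAddCommGroup H] [InnerProductSpace ℂ H] [CompleteSpace H]
  [NormedAddCommGroup Jinf] [InnerProductSpace ℂ Jinf] [CompleteSpace Jinf]
  [NormedAddCommGroup Jzero] [InnerProductSpace ℂ Jzero] [CompleteSpace Jzero]
  {T : Amp d H →L[ℂ] H} (γ : ModelTriple (isometricPart T) Jinf Jzero)

theorem op_mem (z : UBall d) (u : Jzero) : γ.op z u ∈ defectSpace (isometricPart T) z :=
  (γ.atBall z u).2

theorem exists_op_eq {z : UBall d} {h : H} (hh : h ∈ defectSpace (isometricPart T) z) :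
    ∃ u, γ.op z u = h :=
  ⟨(γ.atBall z).symm ⟨h, hh⟩, by simp [op]⟩

theorem op_injective (z : UBall d) : Function.Injective (γ.op z) :=
  Subtype.val_injective.comp (γ.atBall z).injective

theorem adjoint_op_zero_comp : (γ.op (UBall.zero d))† ∘L γ.op (UBall.zero d) = 1 :=
  (norm_map_iff_adjoint_comp_self _).1 γ.atZero_isometry

theorem adjoint_opInfty_comp : γ.opInfty† ∘L γ.opInfty = 1 :=
  (norm_map_iff_adjoint_comp_self _).1 γ.atInfty.norm_map

theorem adjoint_op_zero_op_zero (u : Jzero) :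
    ((γ.op (UBall.zero d))†) (γ.op (UBall.zero d) u) = u :=
  congrArg (fun A : Jzero →L[ℂ] Jzero => A u) γ.adjoint_op_zero_comp

theorem adjoint_opInfty_opInfty (u : Jinf) : (γ.opInfty†) (γ.opInfty u) = u :=
  congrArg (fun A : Jinf →L[ℂ] Jinf => A u) γ.adjoint_opInfty_comp

theorem isometricPart_opInfty (g : Jinf) : isometricPart T (γ.opInfty g) = 0 :=
  (γ.atInfty g).2

theorem kerDefectProj_opInfty (hT : ‖T‖ ≤ 1) (g : Jinf) :
    kerDefectProj T (γ.opInfty g) = 0 :=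
  (isometricPart_eq_zero_iff hT _).1 (γ.isometricPart_opInfty g)

theorem adjoint_isometricPart_op_zero (hT : ‖T‖ ≤ 1) (u : Jzero) :
    ((isometricPart T)†) (γ.op (UBall.zero d) u) = 0 :=
  (mem_defectSpace_zero_iff hT _).1 (γ.op_mem _ u)

theorem adjoint_op_zero_isometricPart (hT : ‖T‖ ≤ 1) (x : Amp d H) :
    ((γ.op (UBall.zero d))†) (isometricPart T x) = 0 := by
  refine ext_inner_left ℂ fun u => ?_
  rw [adjoint_inner_right, ← adjoint_inner_left, γ.adjoint_isometricPart_op_zero hT,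
    inner_zero_left, inner_zero_right]

theorem op_zero_adjoint_of_mem (hT : ‖T‖ ≤ 1) {h : H} (hh : ((isometricPart T)†) h = 0) :
    γ.op (UBall.zero d) (((γ.op (UBall.zero d))†) h) = h := by
  obtain ⟨u, rfl⟩ := γ.exists_op_eq ((mem_defectSpace_zero_iff hT h).2 hh)
  rw [adjoint_op_zero_op_zero]

theorem op_zero_adjoint (hT : ‖T‖ ≤ 1) (h : H) :
    γ.op (UBall.zero d) (((γ.op (UBall.zero d))†) h)
      = h - isometricPart T (((isometricPart T)†) h) := by
  have h1 : ((isometricPart T)†) (h - isometricPart T (((isometricPart T)†) h)) = 0 := by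
    rw [map_sub, adjoint_isometricPart_isometricPart hT, adjoint_isometricPart_apply,
      kerDefectProj_idem, sub_self]
  have h2 := γ.op_zero_adjoint_of_mem hT h1
  rwa [map_sub, γ.adjoint_op_zero_isometricPart hT, sub_zero] at h2

theorem opInfty_adjoint (hT : ‖T‖ ≤ 1) (x : Amp d H) :
    γ.opInfty ((γ.opInfty†) x) = x - kerDefectProj T x := by
  have h1 : isometricPart T (x - kerDefectProj T x) = 0 := by
    rw [map_sub, isometricPart_kerDefectProj, sub_self]
  have h2 : γ.opInfty (γ.atInfty.symm ⟨_, h1⟩) = x - kerDefectProj T x := by simp [opInfty]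
  have h3 : (γ.opInfty†) (kerDefectProj T x) = 0 := by
    refine ext_inner_left ℂ fun u => ?_
    rw [adjoint_inner_right, ← adjoint_inner_left, adjoint_kerDefectProj,
      γ.kerDefectProj_opInfty hT, inner_zero_left, inner_zero_right]
  have h4 := congrArg (γ.opInfty†) h2
  rw [adjoint_opInfty_opInfty, map_sub, h3, sub_zero] at h4
  rw [← h4, h2]

theorem zeroPoint_apply (g : Jinf) :
    γ.zeroPoint T g = -(((γ.op (UBall.zero d))†) (T (γ.opInfty g))) := rfl

theorem T_opInfty (hT : ‖T‖ ≤ 1) (g : Jinf) :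
    T (γ.opInfty g) = -γ.op (UBall.zero d) (γ.zeroPoint T g) := by
  rw [zeroPoint_apply, map_neg, neg_neg, γ.op_zero_adjoint hT, adjoint_isometricPart_T hT,
    γ.kerDefectProj_opInfty hT, map_zero, sub_zero]

theorem adjoint_zeroPoint_apply (u : Jzero) :
    ((γ.zeroPoint T)†) u = -((γ.opInfty†) ((T†) (γ.op (UBall.zero d) u))) := by
  simp [zeroPoint, adjoint_comp]

theorem adjoint_T_op_zero (hT : ‖T‖ ≤ 1) (u : Jzero) :
    (T†) (γ.op (UBall.zero d) u) = -γ.opInfty (((γ.zeroPoint T)†) u) := by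
  rw [adjoint_zeroPoint_apply, map_neg, neg_neg, γ.opInfty_adjoint hT,
    ← adjoint_isometricPart_apply, γ.adjoint_isometricPart_op_zero hT, sub_zero]

/-- The defect model of a row contraction given by a model triple. -/
def defectModel (hT : ‖T‖ ≤ 1) : DefectModel T Jinf Jzero where
  src := γ.opInfty
  tgt := γ.op (UBall.zero d)
  δ := γ.zeroPoint T
  src_isometry := γ.adjoint_opInfty_comp
  tgt_isometry := γ.adjoint_op_zero_comp
  comp_src := ContinuousLinearMap.ext fun g => γ.T_opInfty hT g
  adjoint_comp_tgt := ContinuousLinearMap.ext fun u => γ.adjoint_T_op_zero hT u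
  defect := by
    refine ContinuousLinearMap.ext fun x => ?_
    change x - (T†) (T x) = γ.opInfty ((γ.opInfty†) x
      - ((γ.zeroPoint T)†) (γ.zeroPoint T ((γ.opInfty†) x)))
    have h := congrArg (T†) (γ.T_opInfty hT ((γ.opInfty†) x))
    rw [map_neg, γ.adjoint_T_op_zero hT, neg_neg, γ.opInfty_adjoint hT, map_sub, map_sub,
      adjoint_T_T_kerDefectProj hT] at h
    rw [map_sub, ← h, γ.opInfty_adjoint hT]
    abel
  codefect := by
    refine ContinuousLinearMap.ext fun h => ?_
    change h - T ((T†) h) = γ.op (UBall.zero d) (((γ.op (UBall.zero d))†) h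
      - γ.zeroPoint T (((γ.zeroPoint T)†) (((γ.op (UBall.zero d))†) h)))
    have h1 := congrArg T (γ.adjoint_T_op_zero hT (((γ.op (UBall.zero d))†) h))
    rw [map_neg, γ.T_opInfty hT, neg_neg, γ.op_zero_adjoint hT, map_sub, map_sub,
      adjoint_T_isometricPart hT, ← isometricPart_apply] at h1
    rw [map_sub, ← h1, γ.op_zero_adjoint hT]
    abel

theorem isom_defectModel (hT : ‖T‖ ≤ 1) : (γ.defectModel hT).isom = isometricPart T := by
  refine ContinuousLinearMap.ext fun x => ?_
  change T x + γ.op (UBall.zero d) (γ.zeroPoint T ((γ.opInfty†) x)) = _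
  have h := γ.T_opInfty hT ((γ.opInfty†) x)
  rw [γ.opInfty_adjoint hT, map_sub, ← isometricPart_apply] at h
  rw [eq_neg_iff_add_eq_zero] at h
  rw [← sub_eq_zero, ← h]
  abel

/-- The range of `γ(∞)` is `ker V = (ker D_T)ᗮ`, while `D_δ g = 0` puts `γ(∞) g` into `ker D_T`.
This is the purity of `δ`. -/
theorem defectOp_zeroPoint_injective (hT : ‖T‖ ≤ 1) (g : Jinf)
    (hg : defectOp (γ.zeroPoint T) g = 0) : g = 0 := by
  have h1 : defectOp T (γ.opInfty g) = 0 := by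
    rw [(γ.defectModel hT).defectOp_eq hT]
    change γ.opInfty (defectOp (γ.zeroPoint T) ((γ.opInfty†) (γ.opInfty g))) = 0
    rw [adjoint_opInfty_opInfty, hg, map_zero]
  have h2 : kerDefectProj T (γ.opInfty g) = γ.opInfty g :=
    Submodule.starProjection_eq_self_iff.2 h1
  rw [γ.kerDefectProj_opInfty hT] at h2
  rw [← γ.adjoint_opInfty_opInfty g, ← h2, map_zero]

theorem op_zero_adjoint_op (hT : ‖T‖ ≤ 1) (z : UBall d) (u : Jzero) :
    γ.op (UBall.zero d) (((γ.op (UBall.zero d))†) (γ.op z u))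
      = γ.op z u - isometricPart T (starCol H z (γ.op z u)) := by
  rw [← γ.op_zero_adjoint_of_mem hT ((mem_defectSpace_iff hT z _).1 (γ.op_mem z u)), map_sub,
    γ.adjoint_op_zero_isometricPart hT, sub_zero]

/-- The adjoint `γ(0)* γ(z)` represents `I - V z*` as a map from the `z`-defect space onto the
defect space at `0`, with inverse `(I - V z*)⁻¹`. -/
theorem isUnit_opD (hT : ‖T‖ ≤ 1) (z : UBall d) : IsUnit (γ.opD z) := by
  have hV := norm_isometricPart_le hT
  have h1 : γ.opD z = star ((γ.op (UBall.zero d))† ∘L γ.op z) := by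
    rw [star_eq_adjoint, adjoint_comp, adjoint_adjoint]; rfl
  rw [h1]
  refine IsUnit.star ?_
  rw [ContinuousLinearMap.isUnit_iff_bijective]
  constructor
  · refine (injective_iff_map_eq_zero _).2 fun u hu => ?_
    have h2 := γ.op_zero_adjoint_op hT z u
    change ((γ.op (UBall.zero d))†) (γ.op z u) = 0 at hu
    rw [hu, map_zero] at h2
    have h3 : γ.op z u = 0 := by
      have := congrArg (fun A : H →L[ℂ] H => A (γ.op z u)) (resolv_comp hV z)
      change resolv _ z (γ.op z u - isometricPart T (starCol H z (γ.op z u))) = γ.op z u at this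
      rw [← this, ← h2, map_zero]
    exact γ.op_injective z (h3.trans (map_zero _).symm)
  · intro u
    have h2 := resolv_apply_eq hV z (γ.op (UBall.zero d) u)
    rw [← sub_eq_iff_eq_add] at h2
    obtain ⟨v, hv⟩ := γ.exists_op_eq (z := z) (h := resolv (isometricPart T) z
      (γ.op (UBall.zero d) u)) (by
        rw [mem_defectSpace_iff hT, h2, γ.adjoint_isometricPart_op_zero hT])
    refine ⟨v, ?_⟩
    change ((γ.op (UBall.zero d))†) (γ.op z v) = u
    rw [hv, resolv_apply_eq hV, map_add, γ.adjoint_op_zero_isometricPart hT, add_zero,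
      adjoint_op_zero_op_zero]

/-- Since `γ(z) = (I - V z*)⁻¹ γ(0) D(z)*`, the factor `D(z)⁻¹` removes all dependence on the choice
of `γ(z)` for `z ≠ 0`. -/
theorem charFun_eq (hT : ‖T‖ ≤ 1) (z : UBall d) :
    γ.charFun z = (γ.defectModel hT).isomTransfer z := by
  have hV := norm_isometricPart_le hT
  have h1 : rowOp Jzero z ∘L γ.opN z = (γ.op z)† ∘L rowOp H z ∘L γ.opInfty := by
    rw [opN, ← comp_assoc, rowOp_comp_ampOp, comp_assoc]
  have h2 : (γ.op z)† = γ.opD z ∘L (γ.op (UBall.zero d))† ∘L (resolv (isometricPart T) z)† := by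
    have h3 : γ.op z
        = resolv (isometricPart T) z ∘L γ.op (UBall.zero d) ∘L (γ.op (UBall.zero d))† ∘L γ.op z := by
      refine ContinuousLinearMap.ext fun u => ?_
      have := congrArg (fun A : H →L[ℂ] H => A (γ.op z u)) (resolv_comp hV z)
      change resolv _ z (γ.op z u - isometricPart T (starCol H z (γ.op z u))) = γ.op z u at this
      rw [← γ.op_zero_adjoint_op hT] at this
      exact this.symm
    conv_lhs => rw [h3]
    simp only [adjoint_comp, adjoint_adjoint, opD, comp_assoc]
  have h4 : Ring.inverse (γ.opD z) ∘L γ.opD z = 1 :=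
    Ring.inverse_mul_cancel _ (γ.isUnit_opD hT z)
  rw [charFun, h1, h2, comp_assoc, ← comp_assoc, h4, DefectModel.isomTransfer,
    γ.isom_defectModel hT]
  rfl

/-- The characteristic function computed from a model triple is the transfer function. -/
theorem isCharFunFor_iff (hT : ‖T‖ ≤ 1) (b : UBall d → Jinf →L[ℂ] Jzero) :
    IsCharFunFor T γ b ↔ b = (γ.defectModel hT).transfer := by
  have h (z : UBall d) := (γ.defectModel hT).frostman hT z
  constructor
  · intro hb
    funext z
    refine ContinuousLinearMap.ext fun g => ?_
    have h1 : defectOp ((γ.zeroPoint T)†) ∘L b z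
        = defectOp ((γ.zeroPoint T)†) ∘L (γ.defectModel hT).transfer z := by
      rw [hb z, γ.charFun_eq hT]
      exact (h z).symm
    refine sub_eq_zero.1 ((γ.defectModel hT).defectOp_adjoint_injective hT
      (γ.defectOp_zeroPoint_injective hT) _ ?_)
    rw [map_sub, sub_eq_zero]
    exact congrArg (fun A : Jinf →L[ℂ] Jzero => A g) h1
  · rintro rfl z
    rw [γ.charFun_eq hT]
    exact h z

end ModelTriple

/-! ### Existence of a model triple -/

section ExistsModelTriple

variable {d : ℕ} {H : Type*} [NormedAddCommGroup H] [InnerProductSpace ℂ H] [CompleteSpace H]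
  {T : Amp d H →L[ℂ] H}

theorem apply_resolv {V : Amp d H →L[ℂ] H} (hV : ‖V‖ ≤ 1) (z : UBall d) (h : H) :
    resolv V z h - V (starCol H z (resolv V z h)) = h :=
  congrArg (fun A : H →L[ℂ] H => A h) (comp_resolv hV z)

theorem resolv_apply {V : Amp d H →L[ℂ] H} (hV : ‖V‖ ≤ 1) (z : UBall d) (h : H) :
    resolv V z (h - V (starCol H z h)) = h :=
  congrArg (fun A : H →L[ℂ] H => A h) (resolv_comp hV z)

theorem resolv_mem_defectSpace (hT : ‖T‖ ≤ 1) (z : UBall d)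
    (h : defectSpace (isometricPart T) (UBall.zero d)) :
    (resolv (isometricPart T) z ∘L Submodule.subtypeL _) h ∈ defectSpace (isometricPart T) z := by
  have h2 := resolv_apply_eq (norm_isometricPart_le hT) z h.1
  rw [← sub_eq_iff_eq_add] at h2
  rw [mem_defectSpace_iff hT, comp_apply, Submodule.subtypeL_apply, h2]
  exact (mem_defectSpace_zero_iff hT _).1 h.2

theorem one_sub_comp_starCol_mem_defectSpace (hT : ‖T‖ ≤ 1) (z : UBall d)
    (h : defectSpace (isometricPart T) z) :
    ((1 - isometricPart T ∘L starCol H z) ∘L Submodule.subtypeL _) h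
      ∈ defectSpace (isometricPart T) (UBall.zero d) :=
  (mem_defectSpace_zero_iff hT _).2 ((mem_defectSpace_iff hT z _).1 h.2)

/-- `(I - V z*)⁻¹` as an isomorphism of defect spaces. -/
def defectSpaceEquiv (hT : ‖T‖ ≤ 1) (z : UBall d) :
    defectSpace (isometricPart T) (UBall.zero d) ≃L[ℂ] defectSpace (isometricPart T) z :=
  ContinuousLinearEquiv.equivOfInverse
    (ContinuousLinearMap.codRestrict _ _ (resolv_mem_defectSpace hT z))
    (ContinuousLinearMap.codRestrict _ _ (one_sub_comp_starCol_mem_defectSpace hT z))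
    (fun h => Subtype.ext (apply_resolv (norm_isometricPart_le hT) z h.1))
    (fun h => Subtype.ext (resolv_apply (norm_isometricPart_le hT) z h.1))

/-- The model triple `γ(z) = (I - V z*)⁻¹`. -/
def resolvModelTriple (hT : ‖T‖ ≤ 1) : ModelTriple (isometricPart T)
    (LinearMap.ker (isometricPart T : Amp d H →ₗ[ℂ] H))
    (defectSpace (isometricPart T) (UBall.zero d)) where
  atBall := defectSpaceEquiv hT
  atZero_isometry g := by
    change ‖resolv (isometricPart T) (UBall.zero d) g.1‖ = ‖g.1‖
    rw [resolv, starCol_zero, comp_zero, sub_zero, Ring.inverse_one]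
    rfl
  atInfty := LinearIsometryEquiv.refl ℂ _

end ExistsModelTriple

/-! ### Kernel factorizations, Schur multipliers and de Branges–Rovnyak models -/

theorem UBall.one_sub_dot_ne_zero {d : ℕ} (z w : UBall d) : 1 - UBall.dot z w ≠ 0 := by
  intro h
  have := UBall.norm_dot_lt z w
  rw [← sub_eq_zero.1 h, norm_one] at this
  exact lt_irrefl _ this

theorem RKHS.span_range_kerFun_dense {X V F : Type*} [NormedAddCommGroup V]
    [InnerProductSpace ℂ V] [NormedAddCommGroup F] [InnerProductSpace ℂ F] [RKHS ℂ F X V]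
    [CompleteSpace F] [CompleteSpace V] :
    (Submodule.span ℂ (Set.range fun p : X × V => RKHS.kerFun F p.1 p.2)).topologicalClosure
      = ⊤ := by
  have h := RKHS.kerFun_dense (H := F) (X := X) (V := V) (𝕜 := ℂ)
  have hs : {f : F | ∃ x v, RKHS.kerFun F x v = f}
      = Set.range fun p : X × V => RKHS.kerFun F p.1 p.2 := by
    ext f
    simp
  rwa [hs] at h

section Schur

variable {d : ℕ} {J K H : Type*} [NormedAddCommGroup J] [InnerProductSpace ℂ J] [CompleteSpace J]
  [NormedAddCommGroup K] [InnerProductSpace ℂ K] [CompleteSpace K]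
  [NormedAddCommGroup H] [InnerProductSpace ℂ H] [CompleteSpace H]

/-- The de Branges–Rovnyak kernel of `b` factors through the family `y` of operators. -/
def FactorsKernel (b : UBall d → J →L[ℂ] K) (y : UBall d → K →L[ℂ] H) : Prop :=
  ∀ z w u v, (1 - UBall.dot z w) * ⟪y z u, y w v⟫_ℂ = ⟪u, v⟫_ℂ - ⟪((b z)†) u, ((b w)†) v⟫_ℂ

/-- A function whose de Branges–Rovnyak kernel factors is in the Schur class. -/
def SchurClass.ofFactorsKernel (b : UBall d → J →L[ℂ] K) (y : UBall d → K →L[ℂ] H)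
    (h : FactorsKernel b y) : SchurClass d J K where
  toFun := b
  exists_mul := by
    -- `N` is the adjoint of the multiplication operator, prescribed on kernel functions by `k_z u ↦
    -- k_z b(z)* u`; the Gram matrix of the `y z u` is the slack that makes it a contraction.
    obtain ⟨N, hN, hNk⟩ := exists_contraction_of_gram
      (a := fun p : UBall d × K => RKHS.kerFun (DruryArveson d K) p.1 p.2)
      (c := fun p : UBall d × K => RKHS.kerFun (DruryArveson d J) p.1 (((b p.1)†) p.2))
      (f := fun p : UBall d × K => y p.1 p.2) RKHS.span_range_kerFun_dense (by
        rintro ⟨z, u⟩ ⟨w, v⟩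
        rw [inner_kerFun_druryArveson, inner_kerFun_druryArveson]
        have h1 := UBall.one_sub_dot_ne_zero z w
        have h2 := h z w u v
        field_simp
        linear_combination -h2)
    refine ⟨N†, norm_adjoint_le_one hN, fun f z => ext_inner_left ℂ fun v => ?_⟩
    rw [← RKHS.kerFun_inner, adjoint_inner_right, hNk (z, v), RKHS.kerFun_inner,
      adjoint_inner_left]

theorem inner_kerFun_dbrSpace (b : SchurClass d J K) (x y : UBall d) (v w : K) :
    ⟪RKHS.kerFun (DBRSpace b) x v, RKHS.kerFun (DBRSpace b) y w⟫_ℂ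
      = (1 - UBall.dot x y)⁻¹ * (⟪v, w⟫_ℂ - ⟪((b.toFun x)†) v, ((b.toFun y)†) w⟫_ℂ) := by
  rw [← RKHS.kernel_inner, kernel_dbrSpace]
  simp [dbrKernel, inner_smul_left, UBall.conj_dot, inner_sub_left, adjoint_inner_right]

/-- The model space of a minimal factorization of the de Branges–Rovnyak kernel. -/
theorem exists_dbrSpace_equiv (b : SchurClass d J K) {y : UBall d → K →L[ℂ] H}
    (h : FactorsKernel b.toFun y)
    (hy : (⨆ z, LinearMap.range (y z : K →ₗ[ℂ] H)).topologicalClosure = ⊤) :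
    ∃ U : DBRSpace b ≃ₗᵢ[ℂ] H, ∀ x z, (U.symm x : DBRSpace b) z = ((y z)†) x := by
  obtain ⟨U, hU⟩ := exists_unitary_of_gram
    (a := fun p : UBall d × K => RKHS.kerFun (DBRSpace b) p.1 p.2)
    (c := fun p : UBall d × K => y p.1 p.2) RKHS.span_range_kerFun_dense (by
      refine top_unique (hy.ge.trans (Submodule.topologicalClosure_mono (iSup_le fun z => ?_)))
      rintro _ ⟨u, rfl⟩
      exact Submodule.subset_span ⟨(z, u), rfl⟩) (by
      rintro ⟨z, u⟩ ⟨w, v⟩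
      rw [inner_kerFun_dbrSpace]
      have h1 := UBall.one_sub_dot_ne_zero z w
      have h2 := h z w u v
      field_simp
      linear_combination -h2)
  refine ⟨U, fun x z => ext_inner_left ℂ fun v => ?_⟩
  rw [← RKHS.kerFun_inner, ← U.inner_map_map, hU (z, v), U.apply_symm_apply, adjoint_inner_right]

theorem adjoint_comp_self_le_iff {F G : Type*} [NormedAddCommGroup F] [InnerProductSpace ℂ F]
    [CompleteSpace F] [NormedAddCommGroup G] [InnerProductSpace ℂ G] [CompleteSpace G]
    {A : J →L[ℂ] F} {B : J →L[ℂ] G} :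
    A† ∘L A ≤ ContinuousLinearMap.id ℂ J - B† ∘L B ↔
      ∀ g, ‖A g‖ ^ 2 ≤ ‖g‖ ^ 2 - ‖B g‖ ^ 2 := by
  have key (g : J) : (ContinuousLinearMap.id ℂ J - B† ∘L B - A† ∘L A).reApplyInnerSelf g
      = ‖g‖ ^ 2 - ‖B g‖ ^ 2 - ‖A g‖ ^ 2 := by
    rw [reApplyInnerSelf_apply]
    simp only [sub_apply, inner_sub_left, comp_apply, adjoint_inner_left, map_sub, id_apply,
      inner_self_eq_norm_sq]
  rw [le_def, isPositive_def']
  simp only [key, sub_nonneg]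
  refine ⟨fun h => h.2, fun h => ⟨?_, h⟩⟩
  exact ((IsSelfAdjoint.one _).sub (isPositive_adjoint_comp_self B).isSelfAdjoint).sub
    (isPositive_adjoint_comp_self A).isSelfAdjoint

theorem adjoint_comp_self_eq_iff {F G : Type*} [NormedAddCommGroup F] [InnerProductSpace ℂ F]
    [CompleteSpace F] [NormedAddCommGroup G] [InnerProductSpace ℂ G] [CompleteSpace G]
    {A : J →L[ℂ] F} {B : J →L[ℂ] G} :
    A† ∘L A = ContinuousLinearMap.id ℂ J - B† ∘L B ↔
      ∀ g, ‖A g‖ ^ 2 = ‖g‖ ^ 2 - ‖B g‖ ^ 2 := by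
  have key (g : J) : ⟪(A† ∘L A) g, g⟫_ℂ = ⟪(ContinuousLinearMap.id ℂ J - B† ∘L B) g, g⟫_ℂ ↔
      ‖A g‖ ^ 2 = ‖g‖ ^ 2 - ‖B g‖ ^ 2 := by
    simp only [sub_apply, inner_sub_left, comp_apply, adjoint_inner_left, id_apply,
      inner_self_eq_norm_sq_to_K]
    norm_cast
  simp only [← key]
  constructor
  · intro h g
    rw [h]
  · intro h
    refine ContinuousLinearMap.coe_injective ((ext_inner_map _ _).1 h)

instance (b : UBall d → J →L[ℂ] K) : CompleteSpace (suppSpace b) :=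
  (Submodule.isClosed_topologicalClosure _).completeSpace_coe

/-! ### Gleason solutions: uniqueness, extremality and support -/

namespace SchurClass

/-- `b` has a unique contractive Gleason solution, and it is extremal. -/
def HasUniqueExtremalSolution (b : SchurClass d J K) : Prop :=
  ∃ B : J →L[ℂ] Amp d (DBRSpace b), b.IsContractiveGleasonSolution B ∧
    b.IsExtremalGleasonSolution B ∧ ∀ B', b.IsContractiveGleasonSolution B' → B' = B

/-- Moves the Gleason problem from `ℋ(b)` to `H`, where evaluation at `z` becomes `y(z)*`. -/
theorem isGleasonSolution_ampOp_comp_iff (b : SchurClass d J K) {y : UBall d → K →L[ℂ] H}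
    {U : DBRSpace b ≃ₗᵢ[ℂ] H} (hU : ∀ x z, (U.symm x : DBRSpace b) z = ((y z)†) x)
    (X : J →L[ℂ] Amp d H) :
    b.IsGleasonSolution (ampOp d (U.symm.toContinuousLinearEquiv : H →L[ℂ] DBRSpace b) ∘L X) ↔
      ∀ z g, b.toFun z g - b.toFun (UBall.zero d) g = ((y z)†) (rowOp H z (X g)) := by
  have key (z : UBall d) (g : J) : ∑ j, z.1 j • ((ampOp d
      (U.symm.toContinuousLinearEquiv : H →L[ℂ] DBRSpace b) ∘L X) g j : DBRSpace b) z
      = ((y z)†) (rowOp H z (X g)) := by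
    rw [rowOp_apply, map_sum]
    refine Finset.sum_congr rfl fun j _ => ?_
    rw [map_smul]
    congr 1
    exact hU _ _
  simp only [IsGleasonSolution, key]

theorem norm_ampOp_comp {b : SchurClass d J K} (U : DBRSpace b ≃ₗᵢ[ℂ] H)
    (X : J →L[ℂ] Amp d H) (g : J) :
    ‖(ampOp d (U.symm.toContinuousLinearEquiv : H →L[ℂ] DBRSpace b) ∘L X) g‖ = ‖X g‖ := by
  simp [PiLp.norm_eq_of_L2]

/-- The closed span of the subspaces `z* ran y(z)`. -/
def colSpan (y : UBall d → K →L[ℂ] H) : Submodule ℂ (Amp d H) :=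
  (⨆ z, (LinearMap.range (y z : K →ₗ[ℂ] H)).map
    (starCol H z : H →ₗ[ℂ] Amp d H)).topologicalClosure

/-- The orthogonal complement consists of the solutions of the homogeneous Gleason problem. -/
theorem mem_orthogonal_colSpan_iff {y : UBall d → K →L[ℂ] H} (x : Amp d H) :
    x ∈ (colSpan y)ᗮ ↔ ∀ z, ((y z)†) (rowOp H z x) = 0 := by
  have key (z : UBall d) (u : K) : ⟪starCol H z (y z u), x⟫_ℂ
      = ⟪u, ((y z)†) (rowOp H z x)⟫_ℂ := by
    rw [adjoint_inner_right, ← adjoint_starCol, adjoint_inner_right]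
  rw [colSpan, Submodule.orthogonal_closure, ← Submodule.iInf_orthogonal, Submodule.mem_iInf]
  refine forall_congr' fun z => ?_
  rw [Submodule.mem_orthogonal]
  constructor
  · intro h
    refine ext_inner_left ℂ fun u => ?_
    rw [← key, inner_zero_right]
    exact h _ ⟨_, ⟨u, rfl⟩, rfl⟩
  · rintro h _ ⟨_, ⟨u, rfl⟩, rfl⟩
    exact (key z u).trans (by rw [h, inner_zero_right])

/-- A multiplier with a given extremal Gleason solution `σ` has a unique contractive solution
if and only if the range of `σ` is contained in the closed span of the `z* ran y(z)`. -/
theorem hasUniqueExtremalSolution_iff (b : SchurClass d J K) {y : UBall d → K →L[ℂ] H}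
    (h : FactorsKernel b.toFun y)
    (hy : (⨆ z, LinearMap.range (y z : K →ₗ[ℂ] H)).topologicalClosure = ⊤)
    (σ : J →L[ℂ] Amp d H)
    (hσ : ∀ z g, b.toFun z g - b.toFun (UBall.zero d) g = ((y z)†) (rowOp H z (σ g)))
    (hσn : ∀ g, ‖σ g‖ ^ 2 = ‖g‖ ^ 2 - ‖b.toFun (UBall.zero d) g‖ ^ 2) :
    b.HasUniqueExtremalSolution ↔ ∀ g, σ g ∈ colSpan y := by
  obtain ⟨U, hU⟩ := exists_dbrSpace_equiv b h hy
  set A : Amp d H →L[ℂ] Amp d (DBRSpace b) :=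
    ampOp d (U.symm.toContinuousLinearEquiv : H →L[ℂ] DBRSpace b) with hA
  have hG := b.isGleasonSolution_ampOp_comp_iff hU
  have hn := norm_ampOp_comp U
  rw [← hA] at hG
  have hcσ : b.IsContractiveGleasonSolution (A ∘L σ) :=
    ⟨(hG σ).2 hσ, adjoint_comp_self_le_iff.2 fun g => by rw [hn, hσn]⟩
  constructor
  · rintro ⟨B, -, -, huniq⟩ g
    have : CompleteSpace (colSpan y) :=
      (Submodule.isClosed_topologicalClosure _).completeSpace_coe
    -- Projecting onto `colSpan y` changes `σ` only by a homogeneous solution and does not increase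
    -- norms, so uniqueness forces `X = σ`.
    set X : J →L[ℂ] Amp d H := (colSpan y).starProjection ∘L σ with hX
    have hcX : b.IsContractiveGleasonSolution (A ∘L X) := by
      refine ⟨(hG X).2 fun z g => ?_, adjoint_comp_self_le_iff.2 fun g => ?_⟩
      · have h1 := (mem_orthogonal_colSpan_iff _).1
          ((colSpan y).sub_starProjection_mem_orthogonal (σ g)) z
        rw [map_sub, map_sub, sub_eq_zero] at h1
        rw [hσ, h1]; rfl
      · rw [hn, ← hσn]
        exact pow_le_pow_left₀ (norm_nonneg _) ((colSpan y).norm_starProjection_apply_le _) 2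
    have h2 : A ∘L (X - σ) = 0 := by
      rw [comp_sub, huniq _ hcX, huniq _ hcσ, sub_self]
    have h3 : X g - σ g = 0 := by
      rw [← norm_eq_zero, ← sub_apply, ← hn, ← hA, h2, zero_apply, norm_zero]
    rw [← sub_eq_zero.1 h3]
    exact Submodule.starProjection_apply_mem _ _
  · intro hM
    refine ⟨A ∘L σ, hcσ, ⟨hcσ.1, adjoint_comp_self_eq_iff.2 fun g => by rw [hn, hσn]⟩, ?_⟩
    intro B' hB'
    set X : J →L[ℂ] Amp d H := ampOp d (U.toContinuousLinearEquiv : DBRSpace b →L[ℂ] H) ∘L B'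
      with hX
    have hB : B' = A ∘L X := by
      ext g j
      simp [hA, hX]
    rw [hB] at hB' ⊢
    congr 1
    ext1 g
    -- `σ g` is orthogonal to the difference of the solutions, and contractivity says `‖X g‖ ≤ ‖σ
    -- g‖`; Pythagoras leaves no room for a difference.
    have h1 : X g - σ g ∈ (colSpan y)ᗮ := by
      refine (mem_orthogonal_colSpan_iff _).2 fun z => ?_
      rw [map_sub, map_sub, ← hσ, ← (hG X).1 hB'.1, sub_self]
    have h2 := adjoint_comp_self_le_iff.1 hB'.2 g
    rw [hn, ← hσn] at h2
    have h3 : ⟪σ g, X g - σ g⟫_ℂ = 0 := Submodule.inner_right_of_mem_orthogonal (hM g) h1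
    have h4 := norm_add_sq_eq_norm_sq_add_norm_sq_of_inner_eq_zero _ _ h3
    rw [add_sub_cancel] at h4
    have h5 : ‖X g - σ g‖ * ‖X g - σ g‖ ≤ 0 := by nlinarith
    exact sub_eq_zero.1 (norm_eq_zero.1 (mul_self_eq_zero.1
      (le_antisymm h5 (mul_self_nonneg _))))

theorem mem_orthogonal_suppSpace_iff (b : UBall d → J →L[ℂ] K) (g : J) :
    g ∈ (suppSpace b)ᗮ ↔ ∀ z, b z g = 0 := by
  rw [suppSpace, Submodule.orthogonal_closure, ← Submodule.iInf_orthogonal, Submodule.mem_iInf]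
  refine forall_congr' fun z => ?_
  rw [Submodule.mem_orthogonal]
  constructor
  · intro h
    refine ext_inner_left ℂ fun u => ?_
    rw [inner_zero_right, ← adjoint_inner_left]
    exact h _ ⟨u, rfl⟩
  · rintro h _ ⟨u, rfl⟩
    exact (adjoint_inner_left (b z) g u).trans (by rw [h, inner_zero_right])

theorem suppSpace_eq_top_iff (b : UBall d → J →L[ℂ] K) :
    suppSpace b = ⊤ ↔ ∀ g, (∀ z, b z g = 0) → g = 0 := by
  simp only [← Submodule.orthogonal_eq_bot_iff, Submodule.eq_bot_iff, mem_orthogonal_suppSpace_iff]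

/-- Composing the solution `B` with the projection onto the support gives another contractive
solution, so `B` vanishes on the complement of the support. There `b(0)` vanishes too, and
extremality reads `‖B g‖ = ‖g‖`. -/
theorem suppSpace_eq_top {b : SchurClass d J K} (hb : b.HasUniqueExtremalSolution) :
    suppSpace b.toFun = ⊤ := by
  obtain ⟨B, hBc, hBe, huniq⟩ := hb
  set P := (suppSpace b.toFun).starProjection with hP
  have hbP (z : UBall d) (g : J) : b.toFun z (P g) = b.toFun z g := by
    have := (mem_orthogonal_suppSpace_iff b.toFun _).1
      ((suppSpace b.toFun).sub_starProjection_mem_orthogonal g) z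
    rw [map_sub, sub_eq_zero] at this
    exact this.symm
  have h1 : b.IsContractiveGleasonSolution (B ∘L P) := by
    refine ⟨fun z g => ?_, adjoint_comp_self_le_iff.2 fun g => ?_⟩
    · rw [comp_apply, ← hBc.1, hbP, hbP]
    · refine (adjoint_comp_self_le_iff.1 hBc.2 (P g)).trans ?_
      rw [hbP]
      gcongr
      exact (suppSpace b.toFun).norm_starProjection_apply_le g
  refine (suppSpace_eq_top_iff _).2 fun g hg => ?_
  have h2 := adjoint_comp_self_eq_iff.1 hBe.2 g
  have h3 : P g = 0 := (Submodule.starProjection_apply_eq_zero_iff _).2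
    ((mem_orthogonal_suppSpace_iff b.toFun g).2 hg)
  rw [hg, ← huniq _ h1, comp_apply, h3, map_zero] at h2
  simpa using h2.symm

end SchurClass

end Schur

/-! ### The QE condition and Gleason solutions of the transfer function -/

namespace DefectModel

variable {d : ℕ} {H J K J' K' : Type*} [NormedAddCommGroup H] [InnerProductSpace ℂ H]
  [CompleteSpace H] [NormedAddCommGroup J] [InnerProductSpace ℂ J] [CompleteSpace J]
  [NormedAddCommGroup K] [InnerProductSpace ℂ K] [CompleteSpace K]
  [NormedAddCommGroup J'] [InnerProductSpace ℂ J'] [CompleteSpace J']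
  [NormedAddCommGroup K'] [InnerProductSpace ℂ K'] [CompleteSpace K']
  {T : Amp d H →L[ℂ] H} (m : DefectModel T J K)

theorem adjoint_transfer_mem_suppSpace (z : UBall d) (u : K) :
    ((m.transfer z)†) u ∈ suppSpace m.transfer :=
  Submodule.le_topologicalClosure _ (Submodule.mem_iSup_of_mem z ⟨u, rfl⟩)

theorem iSup_range_kerVec (hT : ‖T‖ ≤ 1) (hC : IsCCNC T) :
    (⨆ z, LinearMap.range (m.kerVec z : K →ₗ[ℂ] H)).topologicalClosure = ⊤ := by
  simp only [m.range_kerVec hT]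
  exact hC

/-- Under the CCNC condition, the QE condition says that `D_T` maps the support of the transfer
function into the closed span of the subspaces `z* (I - T z*)⁻¹ ran D_{T*}`. -/
theorem satisfiesQECondition_iff (hT : ‖T‖ ≤ 1) (hC : IsCCNC T) :
    SatisfiesQECondition T ↔ ∀ g ∈ suppSpace m.transfer,
      m.src (defectOp m.δ g) ∈ SchurClass.colSpan m.kerVec := by
  have hM : SatisfiesQECondition T ↔ ∀ h, (T†) h ∈ SchurClass.colSpan m.kerVec := by
    rw [SatisfiesQECondition, SchurClass.colSpan]
    simp only [m.range_kerVec hT]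
    rw [T.orthogonal_ker]
    constructor
    · intro h x
      exact h (Submodule.le_topologicalClosure _ ⟨x, rfl⟩)
    · intro h
      refine Submodule.topologicalClosure_minimal _ ?_ (Submodule.isClosed_topologicalClosure _)
      rintro _ ⟨x, rfl⟩
      exact h x
  have hclosed : IsClosed (SchurClass.colSpan m.kerVec : Set (Amp d H)) :=
    Submodule.isClosed_topologicalClosure _
  have hz (z : UBall d) (u : K) : starCol H z (m.kerVec z u) ∈ SchurClass.colSpan m.kerVec :=
    Submodule.le_topologicalClosure _ (Submodule.mem_iSup_of_mem z ⟨_, ⟨u, rfl⟩, rfl⟩)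
  rw [hM]
  constructor
  · intro h g hg
    have hle : suppSpace m.transfer ≤ (SchurClass.colSpan m.kerVec).comap
        ((m.src ∘L defectOp m.δ : J →L[ℂ] Amp d H) : J →ₗ[ℂ] Amp d H) := by
      refine Submodule.topologicalClosure_minimal _ (iSup_le fun z => ?_)
        (hclosed.preimage (m.src ∘L defectOp m.δ).continuous)
      rintro _ ⟨u, rfl⟩
      change m.src (defectOp m.δ (((m.transfer z)†) u)) ∈ SchurClass.colSpan m.kerVec
      rw [m.src_defectOp_adjoint_transfer hT]
      exact Submodule.sub_mem _ (hz z u) (h _)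
    exact hle hg
  · intro h x
    -- Only vectors `K(z) u` are controlled by the identity for `D_T Θ(z)*`; CCNC extends the
    -- conclusion to all of `H`.
    have hle : (⨆ z, LinearMap.range (m.kerVec z : K →ₗ[ℂ] H)).topologicalClosure ≤
        (SchurClass.colSpan m.kerVec).comap (T† : H →ₗ[ℂ] Amp d H) := by
      refine Submodule.topologicalClosure_minimal _ (iSup_le fun z => ?_)
        (hclosed.preimage (T†).continuous)
      rintro _ ⟨u, rfl⟩
      have h1 := h _ (m.adjoint_transfer_mem_suppSpace z u)
      rw [m.src_defectOp_adjoint_transfer hT] at h1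
      exact (Submodule.sub_mem_iff_right _ (hz z u)).1 h1
    rw [m.iSup_range_kerVec hT hC] at hle
    exact hle Submodule.mem_top

section Restriction

variable {b : UBall d → J' →L[ℂ] K'} {R : K ≃ₗᵢ[ℂ] K'} {W : J' ≃ₗᵢ[ℂ] suppSpace m.transfer}

/-- `Θ(z)*` already takes values in the support, so no projection appears in the adjoint of the
restriction. Hence restricting to the support leaves the de Branges–Rovnyak kernel unchanged. -/
theorem coe_adjoint_restriction (hb : ∀ z g, b z g = R (m.transfer z (W g))) (z : UBall d)
    (v : K') : (W (((b z)†) v) : J) = ((m.transfer z)†) (R.symm v) := by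
  have h : W (((b z)†) v) = ⟨_, m.adjoint_transfer_mem_suppSpace z (R.symm v)⟩ := by
    refine ext_inner_right ℂ fun s => ?_
    obtain ⟨g, rfl⟩ := W.surjective s
    rw [W.inner_map_map, adjoint_inner_left, hb, Submodule.coe_inner, adjoint_inner_left,
      ← R.inner_map_map, R.apply_symm_apply]
  rw [h]

theorem factorsKernel_restriction (hT : ‖T‖ ≤ 1)
    (hb : ∀ z g, b z g = R (m.transfer z (W g))) :
    FactorsKernel b fun z =>
      m.kerVec z ∘L (R.symm.toContinuousLinearEquiv : K' →L[ℂ] K) := by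
  intro z w u v
  have h := m.inner_kerVec hT z w (R.symm u) (R.symm v)
  rw [← W.inner_map_map, Submodule.coe_inner, m.coe_adjoint_restriction hb,
    m.coe_adjoint_restriction hb]
  rw [R.symm.inner_map_map] at h
  exact h

/-- A Schur multiplier that coincides with the restriction of the transfer function to its support
has a unique contractive Gleason solution, and an extremal one, exactly when `T` obeys the QE
condition. -/
theorem hasUniqueExtremalSolution_iff (hT : ‖T‖ ≤ 1) (hC : IsCCNC T) {b : SchurClass d J' K'}
    (hb : ∀ z g, b.toFun z g = R (m.transfer z (W g))) :
    b.HasUniqueExtremalSolution ↔ SatisfiesQECondition T := by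
  set y : UBall d → K' →L[ℂ] H := fun z =>
    m.kerVec z ∘L (R.symm.toContinuousLinearEquiv : K' →L[ℂ] K) with hy
  have hrange (z : UBall d) : LinearMap.range (y z : K' →ₗ[ℂ] H)
      = LinearMap.range (m.kerVec z : K →ₗ[ℂ] H) := by
    ext h
    constructor
    · rintro ⟨u, rfl⟩
      exact ⟨R.symm u, rfl⟩
    · rintro ⟨u, rfl⟩
      exact ⟨R u, by simp [hy]⟩
  have hdense : (⨆ z, LinearMap.range (y z : K' →ₗ[ℂ] H)).topologicalClosure = ⊤ := by
    simp only [hrange]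
    exact m.iSup_range_kerVec hT hC
  have hcol : SchurClass.colSpan y = SchurClass.colSpan m.kerVec := by
    simp only [SchurClass.colSpan, hrange]
  -- The solution given by `D_T`: since `Θ(0) = δ`, the formula for `Θ` is its Gleason identity, and
  -- `‖D_δ g‖² = ‖g‖² - ‖δ g‖²` is its extremality.
  set σ : J' →L[ℂ] Amp d H := m.src ∘L defectOp m.δ ∘L (suppSpace m.transfer).subtypeL ∘L
    (W.toContinuousLinearEquiv : J' →L[ℂ] suppSpace m.transfer) with hσ
  have hσg (g : J') : σ g = m.src (defectOp m.δ (W g)) := rfl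
  rw [b.hasUniqueExtremalSolution_iff (m.factorsKernel_restriction hT hb) hdense σ ?_ ?_,
    m.satisfiesQECondition_iff hT hC, hcol]
  · constructor
    · intro h g hg
      simpa [hσg] using h (W.symm ⟨g, hg⟩)
    · intro h g
      exact h _ (W g).2
  · intro z g
    refine ext_inner_left ℂ fun u => ?_
    rw [hb, hb, ← map_sub, m.transfer_zero, transfer_apply, add_sub_cancel_left,
      adjoint_inner_right, hσg]
    change _ = ⟪m.kerVec z (R.symm u), _⟫_ℂ
    rw [← adjoint_inner_right, ← R.inner_map_map (R.symm u), R.apply_symm_apply]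
  · intro g
    rw [hσg, m.norm_src, norm_sq_defectOp (m.norm_δ_le hT), hb, R.norm_map, m.transfer_zero]
    congr 2
    exact W.norm_map g

end Restriction

end DefectModel

/-! ### Restriction to the support and the final equivalence -/

section Support

variable {d : ℕ} {J K : Type*} [NormedAddCommGroup J] [InnerProductSpace ℂ J] [CompleteSpace J]
  [NormedAddCommGroup K] [InnerProductSpace ℂ K] [CompleteSpace K]

theorem suppSpace_restrictSupp (b : UBall d → J →L[ℂ] K) : suppSpace (restrictSupp b) = ⊤ := by
  refine (SchurClass.suppSpace_eq_top_iff _).2 fun g hg => ?_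
  have h3 : (g : J) ∈ (suppSpace b)ᗮ := (SchurClass.mem_orthogonal_suppSpace_iff b g).2 hg
  exact Subtype.ext (inner_self_eq_zero (𝕜 := ℂ).1
    (Submodule.inner_right_of_mem_orthogonal g.2 h3))

/-- A function coincides weakly with its restriction to its support. -/
theorem coincideWeakly_restrictSupp (b : UBall d → J →L[ℂ] K) :
    CoincideWeakly b (restrictSupp b) :=
  ⟨LinearIsometryEquiv.refl ℂ K,
    (LinearIsometryEquiv.ofTop _ _ (suppSpace_restrictSupp b)).symm, fun _ _ => rfl⟩

end Support

universe u

/-- A CCNC row contraction that obeys the QE condition is QE, with respect to any model triple. -/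
theorem ModelTriple.isQE_of_satisfiesQECondition {d : ℕ} {H Jinf Jzero : Type u}
    [NormedAddCommGroup H] [InnerProductSpace ℂ H] [CompleteSpace H]
    [NormedAddCommGroup Jinf] [InnerProductSpace ℂ Jinf] [CompleteSpace Jinf]
    [NormedAddCommGroup Jzero] [InnerProductSpace ℂ Jzero] [CompleteSpace Jzero]
    {T : Amp d H →L[ℂ] H} (γ : ModelTriple (isometricPart T) Jinf Jzero) (hT : ‖T‖ ≤ 1)
    (hC : IsCCNC T) (hQ : SatisfiesQECondition T) : IsQE T := by
  have hr (z : UBall d) (g : suppSpace (γ.defectModel hT).transfer) :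
      restrictSupp (γ.defectModel hT).transfer z g = LinearIsometryEquiv.refl ℂ Jzero
        ((γ.defectModel hT).transfer z (LinearIsometryEquiv.refl ℂ
          (suppSpace (γ.defectModel hT).transfer) g)) := rfl
  let b := SchurClass.ofFactorsKernel _ _ ((γ.defectModel hT).factorsKernel_restriction hT hr)
  have hb : b.HasUniqueExtremalSolution :=
    ((γ.defectModel hT).hasUniqueExtremalSolution_iff hT hC (b := b) hr).2 hQ
  have hpure (z : UBall d) : IsPureContraction (b.toFun z) := fun g hg =>
    (γ.defectModel hT).isPureContraction_transfer hT (γ.defectOp_zeroPoint_injective hT) z g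
      fun h => hg (Subtype.ext h)
  exact ⟨hC, Jinf, inferInstance, inferInstance, inferInstance, Jzero, inferInstance,
    inferInstance, inferInstance, γ, (γ.defectModel hT).transfer,
    (γ.isCharFunFor_iff hT _).2 rfl, suppSpace (γ.defectModel hT).transfer, inferInstance,
    inferInstance, inferInstance, Jzero, inferInstance, inferInstance, inferInstance, b,
    ⟨hpure, hb⟩, coincideWeakly_restrictSupp _⟩

end

theorem mainTheorem3 {d : ℕ} {H : Type*} [NormedAddCommGroup H] [InnerProductSpace ℂ H]
    [CompleteSpace H] (T : Amp d H →L[ℂ] H) (hT : ‖T‖ ≤ 1) :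
    IsQE T ↔ (IsCCNC T ∧ SatisfiesQECondition T) := by
  constructor
  · rintro ⟨hC, Jinf, _, _, _, Jzero, _, _, _, γ, bT, hbT, J, _, _, _, K, _, _, _, b,
      ⟨-, hb⟩, R, Q, hRQ⟩
    obtain rfl := (γ.isCharFunFor_iff hT bT).1 hbT
    -- Full support turns weak coincidence into a unitary `W` from all of `J` onto the support of
    -- the transfer function.
    have htop := SchurClass.suppSpace_eq_top hb
    refine ⟨hC, ((γ.defectModel hT).hasUniqueExtremalSolution_iff (R := R)
      (W := (LinearIsometryEquiv.ofTop J _ htop).symm.trans Q.symm) hT hC (b := b) ?_).1 hb⟩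
    intro z g
    have h := hRQ z (Q.symm ((LinearIsometryEquiv.ofTop J _ htop).symm g))
    rw [Q.apply_symm_apply] at h
    exact h.symm
  · rintro ⟨hC, hQ⟩
    have : CompleteSpace (LinearMap.ker (isometricPart T : Amp d H →ₗ[ℂ] H)) :=
      (isometricPart T).isClosed_ker.completeSpace_coe
    have : CompleteSpace (defectSpace (isometricPart T) (UBall.zero d)) :=
      (Submodule.isClosed_orthogonal _).completeSpace_coe
    exact (resolvModelTriple hT).isQE_of_satisfiesQECondition hT hC hQ
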